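/- **Setting.** Fix positive integers $k<n$. Rows are numbered from top to bottom, columns from left to right. A *board* consists of a permutation $\pi$ of $[n]$ (a black checker in row $\pi(j)$ of column $j$, for each $j$) and of $k$ red checkers, ordered from top to bottom. "Northwest" is always meant weakly. *The game.* Let $\alpha_1<\dots<\alpha_k$ and $\beta_1<\dots<\beta_k$ be elements of $[n]$ with $\alpha_i+\beta_{k+1-i}\ge n+1$ for all $i$. The root of the checkerboard game of $(\alpha,\beta)$ has black checkers on the antidiagonal and red checkers in the squares (row $\beta_{k+1-i}$, column $\alpha_i$), $i=1,\dots,k$. Let $\sigma\ne\mathrm{id}$ be the permutation of a node. Its *descending checker* is the black checker in the first column $d$ with $\sigma(d)<\sigma(d-1)$; $r=\sigma(d)$ is the *critical row*. The black checkers in columns $<d$ and rows $>r$ form the *critical diagonal*; its top checker, in row $r+1$ and in a column called $a$, is the *ascending checker*. For every child of the node, the permutation is $\pi$, obtained from $\sigma$ by interchanging rows $r$ and $r+1$ of the descending and ascending checkers. A red checker is "in the critical diagonal" if it is in the square of a black checker of it. The children are as follows. * Case I: no red checker is in row $r$. A red checker in the square $(r+1,a)$ moves to $(r,a)$; otherwise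 nothing moves. One child. * Case II: a red checker is in row $r$ and there is no swap: either there is no red checker in the critical diagonal, and the red checker in row $r$ moves to $(r,a)$ if it is in $(r,d)$ and stays otherwise; or ("stay") the red checker in row $r$ is not in $(r,d)$, the top red checker in the critical diagonal is not in $(r+1,a)$, and no red checker moves. * Case III ("swap"): there are a red checker $(r,c)$ in row $r$ and a top red checker $(R,c')$ in the critical diagonal; they are replaced by $(r,a)$ and $(R,c)$. If $c\ne d$ and $c'\neq a$, this child exists only if no other red checker lies in the rectangle between the two (and it is then a second child, besides "stay"). *Varieties.* Let $\mathbf m_1,\dots,\mathbf m_n$ be an ordered basis of $\mathbb C^n$, i.e. the columns of an invertible matrix $M$. With a permutation $\pi$ it gives the flags $M_i=\langle \mathbf m_1,\dots,\mathbf m_i\rangle$ and $F_j=\langle\mathbf m_{\pi(1)},\dots,\mathbf m_{\pi(j)}\rangle$. For a board $B$ on $\pi$ and a set $S$ of red checkers let $S(F,M)$ be the span of the $\mathbf m_i$ such that the black checker of row $i$ is northwest of some checker in $S$. The checkerboard variety is $$Y_B(F,M)=\{H\in \mathrm{Gr}(k,n)\mid \dim (H\cap S(F,M))\ge \#S\ \text{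 for all sets } S \text{ of red checkers}\}.$$ Let $\mathcal Y_B$ be the set of complex $n\times k$ matrices $(y_{i,j})$ with $y_{i,j}=1$ if the $j$th red checker is in row $i$; $y_{i,j}=0$ if the black checker in row $i$ is not northwest of the $j$th red checker, or shares its square with a different red checker; all other entries being arbitrary. Let $\phi$ send an $n\times k$ matrix of rank $k$ to its column span in $\mathrm{Gr}(k,n)$. *Families.* Let $B'$ be a node, with permutation $\sigma$, of a checkerboard game, and let $B$ be a child of $B'$ with permutation $\pi$ by a move in Case II. Let $M$ be invertible with columns $\mathbf m_1,\dots,\mathbf m_n$, and let $F$ be the flag given by $M$ and $\pi$. Put $M'(0)=M$, and for $t\in\mathbb C$, $t\ne0$, let $M'(t)$ have the columns $\mathbf m'_i(t)=\mathbf m_i$ for $i\ne r,r+1$, $\mathbf m'_r(t)=\mathbf m_r-t\,\mathbf m_{r+1}$, $\mathbf m'_{r+1}(t)=\mathbf m_r$. For $t\in\mathbb C$ let $\mathcal Y_B(t)$ be the set of all matrices $(y_{i,j}(t))$ obtained from the $(y_{i,j})\in\mathcal Y_B$ by $$y_{r+1,j}(t)=y_{r+1,j}-t\,y_{r,j}\quad\text{if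 } j\notin E,\qquad y_{i,j}(t)=y_{i,j}\ \text{ in all other cases},$$ where $j\in E$ means that the row and the column of the $j$th red checker of $B$ both contain black checkers of the critical diagonal of $\sigma$. **Lemma.** For every $t\ne0$, $M'(t)$ is invertible, the flag given by $M'(t)$ and $\sigma$ is again $F$, all matrices in $M\mathcal Y_B(t)$ have rank $k$, and $\phi(M\mathcal Y_B(t))$ is a dense subset of the parent checkerboard variety $Y_{B'}(F,M'(t))$. For $t=0$, all matrices in $M\mathcal Y_B(0)$ have rank $k$, and $\phi(M\mathcal Y_B(0))$ is a dense subset of the child checkerboard variety $Y_B(F,M)$. -/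

import Mathlib

open Topology

/-! ## Checkerboards and the checkerboard game

Rows are numbered from top to bottom and columns from left to right, both by `Fin n`. -/

/-- A permutation array together with `k` red checkers.  The black checker of column `j` lies in
row `black j`, hence the black checker of row `i` lies in column `black.symm i`.  The `j`-th red
checker lies in row `row j` and column `col j`.  (On every board of a checkerboard game, `row` is
strictly increasing: the red checkers are ordered from top to bottom.) -/
structure Board (k n : ℕ) where
  black : Equiv.Perm (Fin n)
  row : Fin k → Fin n
  col : Fin k → Fin n

namespace Board

variable {k n : ℕ}

/-- The black checker of row `i` is (weakly) northwest of the `j`-th red checker. -/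
def NW (B : Board k n) (i : Fin n) (j : Fin k) : Prop :=
  i ≤ B.row j ∧ B.black.symm i ≤ B.col j

/-- The `j`-th red checker lies in the square of the black checker of row `i`. -/
def InSquare (B : Board k n) (i : Fin n) (j : Fin k) : Prop :=
  B.row j = i ∧ B.col j = B.black.symm i

/-- The initial board of the game for the brackets `α` and `β`: black checkers on the
antidiagonal, red checkers in the squares (row `β_i`, column `α_{k+1-i}`). -/
def root (α β : Fin k ↪o Fin n) : Board k n where
  black := Fin.revPerm
  row := fun i => β i
  col := fun i => α i.rev

/-- `d` is the column of the descending checker and `a` the column of the ascending checker.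
In a permutation of the bubble sort the black checkers strictly left of the descending checker run
from northwest to southeast; those below the critical row (the row `σ d` of the descending
checker) form the critical diagonal, whose first (i.e. top) checker, in column `a`, is the
ascending one.  It lies in the row directly below the critical row. -/
def IsCritical (σ : Equiv.Perm (Fin n)) (d a : Fin n) : Prop :=
  (∀ i j, i < j → j < d → σ i < σ j) ∧ a < d ∧ σ d < σ a ∧ ∀ j < a, σ j < σ d

/-- The `j`-th red checker lies in the critical diagonal, i.e. in the square of a black checker
that is left of column `d` of the descending checker and below the critical row. -/
def OnCriticalDiagonal (B : Board k n) (d : Fin n) (j : Fin k) : Prop :=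
  B.col j < d ∧ B.black d < B.row j ∧ B.InSquare (B.row j) j

/-- The `j`-th red checker is the top red checker in the critical diagonal. -/
def IsTopOnCriticalDiagonal (B : Board k n) (d : Fin n) (j : Fin k) : Prop :=
  B.OnCriticalDiagonal d j ∧ ∀ j', B.OnCriticalDiagonal d j' → B.row j ≤ B.row j'

/-- The move of the black checkers: the descending and ascending checkers interchange rows. -/
def BlackMove (d a : Fin n) (B B' : Board k n) : Prop :=
  ∀ j, B'.black j = B.black (Equiv.swap a d j)

/-- Case I: no red checker is in the critical row.  A red checker in the square of the ascending
black checker moves up with it into the critical row; otherwise no red checker moves. -/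
def CaseI (d a : Fin n) (B B' : Board k n) : Prop :=
  BlackMove d a B B' ∧ (∀ j, B.row j ≠ B.black d) ∧
    ((∃ j, B.InSquare (B.black a) j ∧
        B'.row = Function.update B.row j (B.black d) ∧ B'.col = B.col) ∨
     ((∀ j, ¬ B.InSquare (B.black a) j) ∧ B'.row = B.row ∧ B'.col = B.col))

/-- Case II: there is a red checker `s` in the critical row, and no swap takes place.  Either
* there is no red checker in the critical diagonal and `s` is in the square of the descending
  checker; then `s` moves left in its row to the new square of the ascending checker; or
* there is no red checker in the critical diagonal and `s` is elsewhere in the critical row;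
  then no red checker moves; or
* ("stay") `s` is not in the square of the descending checker, and the top red checker in the
  critical diagonal is not in the square of the ascending checker; no red checker moves. -/
def CaseII (d a : Fin n) (B B' : Board k n) : Prop :=
  BlackMove d a B B' ∧ ∃ s, B.row s = B.black d ∧
    (((∀ j, ¬ B.OnCriticalDiagonal d j) ∧ B.col s = d ∧
        B'.row = B.row ∧ B'.col = Function.update B.col s a) ∨
     ((∀ j, ¬ B.OnCriticalDiagonal d j) ∧ B.col s ≠ d ∧ B'.row = B.row ∧ B'.col = B.col) ∨
     ((∃ j, B.IsTopOnCriticalDiagonal d j ∧ B.col j ≠ a) ∧ B.col s ≠ d ∧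
        B'.row = B.row ∧ B'.col = B.col))

/-- Case III ("swap"): there are a red checker `s` in the critical row and a top red checker `j`
in the critical diagonal.  If neither is in the square of the descending, respectively ascending,
checker, then no other red checker ("blocker") may lie in the rectangle between them.  They
exchange columns, and then `s` moves left to the new square of the ascending checker. -/
def CaseIII (d a : Fin n) (B B' : Board k n) : Prop :=
  BlackMove d a B B' ∧ ∃ s j, B.row s = B.black d ∧ B.IsTopOnCriticalDiagonal d j ∧
    (B.col s = d ∨ B.col j = a ∨
      ¬ ∃ z, B.row s < B.row z ∧ B.row z < B.row j ∧ B.col j < B.col z ∧ B.col z < B.col s) ∧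
    B'.row = B.row ∧ B'.col = Function.update (Function.update B.col j (B.col s)) s a

/-- The nodes of the checkerboard game for the brackets `α` and `β` (whose root is a checkerboard
exactly if `α_i + β_{k+1-i} ≥ n + 1` for all `i`, in numbering from `1`). -/
inductive IsNode (α β : Fin k ↪o Fin n) : Board k n → Prop
  | root (h : ∀ i, n ≤ (α i).val + (β i.rev).val + 1) : IsNode α β (Board.root α β)
  | child {B B' : Board k n} {d a : Fin n} (hB : IsNode α β B) (h : IsCritical B.black d a)
      (hm : CaseI d a B B' ∨ CaseII d a B B' ∨ CaseIII d a B B') : IsNode α β B'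

end Board

/-! ## The Grassmannian and the map `φ` -/

/-- `Gr(k,n)`: the `k`-dimensional linear subspaces of `ℂⁿ`. -/
def Gr (k n : ℕ) : Type :=
  {H : Submodule ℂ (Fin n → ℂ) // Module.finrank ℂ H = k}

/-- The Stiefel manifold of `n × k` matrices of rank `k`. -/
abbrev Stiefel (k n : ℕ) : Type :=
  {A : Matrix (Fin n) (Fin k) ℂ // A.rank = k}

/-- The map `φ`: column span. -/
noncomputable def columnSpan {k n : ℕ} (A : Stiefel k n) : Gr k n :=
  ⟨Submodule.span ℂ (Set.range A.1.col), by
    rw [← Matrix.rank_eq_finrank_span_cols]; exact A.2⟩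

/-- The usual (complex, Euclidean) topology of the Grassmannian: the quotient topology along
the column span map from the Stiefel manifold. -/
noncomputable instance (k n : ℕ) : TopologicalSpace (Gr k n) :=
  TopologicalSpace.coinduced columnSpan inferInstance

/-- `φ(M𝒜)` for a set `𝒜` of `n × k` matrices. -/
def phiImage {k n : ℕ} (M : Matrix (Fin n) (Fin n) ℂ) (𝒜 : Set (Matrix (Fin n) (Fin k) ℂ)) :
    Set (Gr k n) :=
  columnSpan '' {A : Stiefel k n | ∃ Y ∈ 𝒜, A.1 = M * Y}

/-- `φ(M𝒜)` is defined (every matrix `MY`, `Y ∈ 𝒜`, has rank `k`), is contained in `V`, and is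
dense in `V`. -/
def PhiImageDenseIn {k n : ℕ} (M : Matrix (Fin n) (Fin n) ℂ)
    (𝒜 : Set (Matrix (Fin n) (Fin k) ℂ)) (V : Set (Gr k n)) : Prop :=
  (∀ Y ∈ 𝒜, (M * Y).rank = k) ∧ phiImage M 𝒜 ⊆ V ∧ V ⊆ closure (phiImage M 𝒜)

/-! ## Checkerboard varieties, Stiefel coordinates, and families -/

/-- The flag `F` determined by an ordered basis (the columns of `M`) and a permutation array `π`:
its `j`-th space is spanned by the basis vectors of the black checkers in the first `j` columns. -/
def flagF {n : ℕ} (π : Equiv.Perm (Fin n)) (M : Matrix (Fin n) (Fin n) ℂ) (j : Fin n) :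
    Submodule ℂ (Fin n → ℂ) :=
  Submodule.span ℂ {v | ∃ l ≤ j, v = M.col (π l)}

namespace Board

variable {k n : ℕ}

/-- `S(F,M)`: the span of the black checkers that are northwest of some red checker in `S`, the
black checker of row `i` being identified with the `i`-th column of `M`. -/
def northwestSpan (B : Board k n) (M : Matrix (Fin n) (Fin n) ℂ) (S : Finset (Fin k)) :
    Submodule ℂ (Fin n → ℂ) :=
  Submodule.span ℂ {v | ∃ i, (∃ j ∈ S, B.NW i j) ∧ v = M.col i}

/-- The checkerboard variety of the board `B` and of the pair of flags `(F, M)` given by the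
columns of the invertible matrix `M` and the permutation array `B.black`. -/
def variety (B : Board k n) (M : Matrix (Fin n) (Fin n) ℂ) : Set (Gr k n) :=
  {H | ∀ S : Finset (Fin k),
    S.card ≤ Module.finrank ℂ (H.1 ⊓ B.northwestSpan M S : Submodule ℂ (Fin n → ℂ))}

/-- The Stiefel coordinates of a board. -/
def stiefelCoords (B : Board k n) : Set (Matrix (Fin n) (Fin k) ℂ) :=
  {Y | ∀ i j, (¬ B.NW i j → Y i j = 0) ∧
    ((∃ j' ≠ j, B.InSquare i j') → Y i j = 0) ∧
    (B.row j = i → Y i j = 1)}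

/-- The `j`-th red checker of `B'` is in region `E` of the move from `σ` in which `d` is the column
of the descending checker: its row and its column both contain black checkers of the critical
diagonal of `σ` (the rows below the critical row, and the columns `c < d` with `σ c` below it). -/
def InRegionE (σ : Equiv.Perm (Fin n)) (d : Fin n) (B' : Board k n) (j : Fin k) : Prop :=
  σ d < B'.row j ∧ B'.col j < d ∧ σ d < σ (B'.col j)

open Classical in
/-- The coordinates `𝒴(t)` of the child board `B'` in Case II: with `r = σ d` the critical row and
`r + 1 = σ a` the row below it, the entry `y_{r+1,j}` is replaced by `y_{r+1,j} - t y_{r,j}`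
unless the `j`-th red checker is in region `E`. -/
noncomputable def familyII (σ : Equiv.Perm (Fin n)) (d a : Fin n) (B' : Board k n) (t : ℂ) :
    Set (Matrix (Fin n) (Fin k) ℂ) :=
  (fun Y : Matrix (Fin n) (Fin k) ℂ => Matrix.of fun i j =>
    if i = σ a ∧ ¬ InRegionE σ d B' j then Y i j - t * Y (σ d) j else Y i j) '' B'.stiefelCoords

end Board

/-- The basis `M'(t)`, `t ≠ 0`, with `m'_r(t) = m_r - t m_{r+1}`, `m'_{r+1}(t) = m_r`, and
`m'_i(t) = m_i` for all other `i`; here `r'` stands for `r + 1`. -/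
noncomputable def movingBasis {n : ℕ} (M : Matrix (Fin n) (Fin n) ℂ) (r r' : Fin n) (t : ℂ) :
    Matrix (Fin n) (Fin n) ℂ :=
  Matrix.of fun i j =>
    if j = r then M i r - t * M i r' else if j = r' then M i r else M i j

/-! ## Spans of vectors and limits in the Grassmannian -/

section Grassmannian

open Filter
open scoped Matrix
open Submodule (span subset_span span_le mem_sup smul_mem)

variable {k n : ℕ}

/-! For each red checker `j`, let `V j` be the span of the basis vectors whose black checkers are
northwest of it. If `c j ∈ V j` and the `c j` are independent, their span clearly satisfies the rank
conditions of the checkerboard variety. The main point is that these transversal spans are dense in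
the variety (`Board.IsSorting.variety_subset_closure`).

To see this, note that every node of the game has a rigid shape (`Board.IsSorting`), so that the
index set of each `V j` is a row bound together with a column bound. For `H` in the variety, the
rank conditions produce two flags in `H`, one adapted to the row bounds and one to the column
bounds. A basis adapted to both (`Submodule.exists_adapted_basis`) obeys the row bound of `j` and
the column bound of `τ j`, for some permutation `τ`. As long as `τ` permutes the bounds in an
essential way, one exchanges bounds: `span (b, x + y)` is the limit of `span (b + ε x, b - ε y)`.
The row `q` of the descending checker, which the column bounds left of it omit, occasionally
requires an exchange of three vectors. A potential shows that the exchanges end at the original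
bounds (`Staircase.rankVariety_subset_closure`).

In Case II the index sets of parent and child differ only in the rows `r` and `r + 1`, in one of
four patterns (`Board.IsSorting.nwChange_of_caseII`). Hence, for `t ≠ 0`, each `V j` of the parent
in the basis `M'(t)` equals the `V j` of the child in the basis `M` after the coordinate shear that
defines the family (`Board.NWChange.map_movingBasis`); at `t = 0` the shear is trivial. Thus both
assertions reduce to one: the family is dense among the transversals of the sheared subspaces.
Indeed, a generic transversal has nonzero entries in the squares' rows and is brought to Stiefel
form by column operations compatible with the shears (`Board.NWChange.exists_normalized`). -/

theorem Gr.linearIndependent_of_span_eq (H : Gr k n) {c : Fin k → Fin n → ℂ}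
    (hc : span ℂ (Set.range c) = H.1) : LinearIndependent ℂ c := by
  rw [linearIndependent_iff_card_eq_finrank_span, Set.finrank, hc, H.2, Fintype.card_fin]

theorem rank_transpose_of_linearIndependent {c : Fin k → Fin n → ℂ} (hc : LinearIndependent ℂ c) :
    (Matrix.of c).transpose.rank = k := by
  rw [Matrix.rank_transpose]
  simpa using LinearIndependent.rank_matrix (M := Matrix.of c) hc

theorem columnSpan_surjective_of_span {H : Gr k n} {c : Fin k → Fin n → ℂ}
    (hc : span ℂ (Set.range c) = H.1) {A : Stiefel k n} (hA : A.1 = (Matrix.of c).transpose) :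
    columnSpan A = H := by
  apply Subtype.ext
  rw [← hc]
  change span ℂ (Set.range A.1.col) = _
  rw [hA]
  rfl

/-- A limit of spans of `k` vectors, as long as the limiting vectors are independent. -/
theorem Gr.mem_closure_of_path {H : Gr k n} {D : Set (Gr k n)} (f : ℂ → Fin k → Fin n → ℂ)
    (hf : ContinuousAt f 0) (hc : span ℂ (Set.range (f 0)) = H.1)
    (h : ∀ᶠ ε in 𝓝[≠] (0 : ℂ), ∀ H' : Gr k n, H'.1 = span ℂ (Set.range (f ε)) → H' ∈ D) :
    H ∈ closure D := by
  have hli := H.linearIndependent_of_span_eq hc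
  rw [mem_closure_iff]
  intro O hO hHO
  have hpre : IsOpen (columnSpan ⁻¹' O : Set (Stiefel k n)) := isOpen_coinduced.1 hO
  obtain ⟨U, hU, hUO⟩ := isOpen_induced_iff.1 hpre
  let T : (Fin k → Fin n → ℂ) → Matrix (Fin n) (Fin k) ℂ := fun c => (Matrix.of c).transpose
  have hT : Continuous T := by
    refine continuous_matrix fun i j => ?_
    exact (continuous_apply i).comp (continuous_apply j)
  have key : ∀ {c : Fin k → Fin n → ℂ} (hc : LinearIndependent ℂ c) (K : Gr k n),
      span ℂ (Set.range c) = K.1 → (T c ∈ U ↔ K ∈ O) := by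
    intro c hc K hK
    have h1 : columnSpan ⟨T c, rank_transpose_of_linearIndependent hc⟩ = K :=
      columnSpan_surjective_of_span hK rfl
    have h2 : (⟨T c, rank_transpose_of_linearIndependent hc⟩ : Stiefel k n) ∈
        Subtype.val ⁻¹' U ↔ (⟨T c, rank_transpose_of_linearIndependent hc⟩ : Stiefel k n) ∈
          columnSpan ⁻¹' O := by rw [hUO]
    rw [Set.mem_preimage, Set.mem_preimage, h1] at h2
    exact h2
  have e1 : ∀ᶠ ε in 𝓝 (0 : ℂ), T (f ε) ∈ U :=
    (hT.continuousAt.comp hf).eventually (hU.mem_nhds ((key hli H hc).2 hHO))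
  have e2 : ∀ᶠ ε in 𝓝 (0 : ℂ), LinearIndependent ℂ (f ε) :=
    -- Independence is an open condition, so nearby points of the path again span points of the
    -- Grassmannian.
    hf.eventually (isOpen_setOfPred_linearIndependent.mem_nhds hli)
  obtain ⟨ε, hε1, hε2, hε3⟩ :=
    ((e1.filter_mono nhdsWithin_le_nhds).and
      ((e2.filter_mono nhdsWithin_le_nhds).and h)).exists
  let K : Gr k n := ⟨span ℂ (Set.range (f ε)), by
    rw [finrank_span_eq_card hε2, Fintype.card_fin]⟩
  exact ⟨K, (key hε2 K rfl).1 hε1, hε3 K rfl⟩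

/-- The subspaces spanned by a transversal of a family of subspaces. -/
def transversalSpans (V : Fin k → Submodule ℂ (Fin n → ℂ)) : Set (Gr k n) :=
  {H | ∃ c : Fin k → Fin n → ℂ, (∀ j, c j ∈ V j) ∧ span ℂ (Set.range c) = H.1}

theorem transversalSpans_mono {V V' : Fin k → Submodule ℂ (Fin n → ℂ)} (h : ∀ j, V j ≤ V' j) :
    transversalSpans V ⊆ transversalSpans V' := by
  rintro H ⟨c, hc, hs⟩
  exact ⟨c, fun j => h j (hc j), hs⟩

theorem Gr.eq_span_of_span_le {H : Gr k n} {f c : Fin k → Fin n → ℂ}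
    (hf : H.1 = span ℂ (Set.range f)) (h : ∀ j, f j ∈ span ℂ (Set.range c)) :
    span ℂ (Set.range c) = H.1 := by
  have hle : H.1 ≤ span ℂ (Set.range c) := by
    rw [hf, span_le]
    rintro _ ⟨j, rfl⟩
    exact h j
  refine (Submodule.eq_of_le_of_finrank_le hle ?_).symm
  rw [H.2]
  exact (finrank_range_le_card (R := ℂ) c).trans_eq (Fintype.card_fin k)

/-- The members of the transversal with index in `S` are independent and lie in both `H` and `W`. -/
theorem Gr.dim_le_of_transversal {V : Fin k → Submodule ℂ (Fin n → ℂ)} {H : Gr k n}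
    (hH : H ∈ transversalSpans V) (S : Finset (Fin k)) {W : Submodule ℂ (Fin n → ℂ)}
    (hW : ∀ j ∈ S, V j ≤ W) : S.card ≤ Module.finrank ℂ (H.1 ⊓ W : Submodule ℂ (Fin n → ℂ)) := by
  obtain ⟨c, hc, hs⟩ := hH
  have hli : LinearIndependent ℂ (fun j : S => c j) :=
    (H.linearIndependent_of_span_eq hs).comp _ Subtype.val_injective
  have h1 := finrank_span_eq_card hli
  rw [Fintype.card_coe] at h1
  rw [← h1]
  apply Submodule.finrank_mono
  rw [span_le]
  rintro _ ⟨j, rfl⟩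
  refine ⟨?_, hW j j.2 (hc j)⟩
  rw [← hs]
  exact subset_span ⟨_, rfl⟩

theorem eventually_ne_zero : ∀ᶠ ε in 𝓝[≠] (0 : ℂ), ε ≠ 0 := eventually_mem_nhdsWithin

theorem continuousAt_update_add_smul (c : Fin k → Fin n → ℂ) (j : Fin k) (x : Fin n → ℂ) :
    ContinuousAt (fun ε : ℂ => Function.update c j (c j + ε • x)) 0 := by
  apply Continuous.continuousAt
  fun_prop

/-- If `V j ⊆ V' j ∩ V' j'` and `V j' ⊆ V' j + V' j'`, then `span (b, x + y)` is the limit of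
`span (b + ε x, b - ε y)`. -/
theorem transversalSpans_subset_closure_of_exchange {V V' : Fin k → Submodule ℂ (Fin n → ℂ)}
    {j j' : Fin k} (hne : j ≠ j') (h1 : V j ≤ V' j) (h2 : V j ≤ V' j')
    (h3 : V j' ≤ V' j ⊔ V' j') (h4 : ∀ i, i ≠ j → i ≠ j' → V i ≤ V' i) :
    transversalSpans V ⊆ closure (transversalSpans V') := by
  rintro H ⟨c, hc, hs⟩
  obtain ⟨x, hx, y, hy, hxy⟩ := mem_sup.1 (h3 (hc j'))
  -- Only `c j` moves along the path. For `ε ≠ 0` the span is also that of `c j + ε x` and `c j - ε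
  -- y` (with the other vectors), because their difference is `ε (x + y) = ε c j'`.
  refine Gr.mem_closure_of_path (fun ε => Function.update c j (c j + ε • x))
    (continuousAt_update_add_smul c j x) (by simpa using hs) ?_
  filter_upwards [eventually_ne_zero] with ε hε K hK
  let c' : Fin k → Fin n → ℂ :=
    Function.update (Function.update c j (c j + ε • x)) j' (c j - ε • y)
  have hcj : c' j = c j + ε • x := by simp [c', hne]
  have hcj' : c' j' = c j - ε • y := by simp [c']
  have hci : ∀ i, i ≠ j → i ≠ j' → c' i = c i := by
    intro i hi hi'
    simp [c', hi, hi']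
  refine ⟨c', ?_, K.eq_span_of_span_le hK ?_⟩
  · intro i
    by_cases hi : i = j
    · subst hi
      rw [hcj]
      exact add_mem (h1 (hc _)) (smul_mem _ _ hx)
    by_cases hi' : i = j'
    · subst hi'
      rw [hcj']
      exact sub_mem (h2 (hc _)) (smul_mem _ _ hy)
    · rw [hci i hi hi']
      exact h4 i hi hi' (hc i)
  · intro i
    have hmem : ∀ i, c' i ∈ span ℂ (Set.range c') := fun i => subset_span ⟨i, rfl⟩
    by_cases hi : i = j
    · subst hi
      simp only [Function.update_self]
      rw [← hcj]
      exact hmem _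
    rw [Function.update_of_ne hi]
    by_cases hi' : i = j'
    · subst hi'
      have : c i = ε⁻¹ • (c' j - c' i) := by
        rw [hcj, hcj', ← hxy, eq_inv_smul_iff₀ hε]
        module
      rw [this]
      exact smul_mem _ _ (sub_mem (hmem _) (hmem _))
    · rw [← hci i hi hi']
      exact hmem _

/-- The exchange of three vectors `b, x + y, b'`, where `x + z = x + y + μ b'`, along
`span (b + ε x, b - ε y, b - ε z)`. -/
theorem Gr.mem_closure_of_triple_exchange {V' : Fin k → Submodule ℂ (Fin n → ℂ)} {H : Gr k n}
    {c : Fin k → Fin n → ℂ} (hs : span ℂ (Set.range c) = H.1)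
    {j₁ j₂ j₃ : Fin k} (h12 : j₁ ≠ j₂) (h13 : j₁ ≠ j₃) (h23 : j₂ ≠ j₃)
    (hb1 : c j₁ ∈ V' j₁) (hb2 : c j₁ ∈ V' j₂) (hb3 : c j₁ ∈ V' j₃)
    {x y z : Fin n → ℂ} (hx : x ∈ V' j₁) (hy : y ∈ V' j₂) (hz : z ∈ V' j₃) {μ : ℂ} (hμ : μ ≠ 0)
    (hxy : x + y = c j₂) (hxz : x + z = c j₂ + μ • c j₃)
    (h4 : ∀ i, i ≠ j₁ → i ≠ j₂ → i ≠ j₃ → c i ∈ V' i) :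
    H ∈ closure (transversalSpans V') := by
  refine Gr.mem_closure_of_path (fun ε => Function.update c j₁ (c j₁ + ε • x))
    (continuousAt_update_add_smul c j₁ x) (by simpa using hs) ?_
  filter_upwards [eventually_ne_zero] with ε hε K hK
  let c' : Fin k → Fin n → ℂ := Function.update (Function.update
    (Function.update c j₁ (c j₁ + ε • x)) j₂ (c j₁ - ε • y)) j₃ (c j₁ - ε • z)
  have hc1 : c' j₁ = c j₁ + ε • x := by simp [c', h12, h13]
  have hc2 : c' j₂ = c j₁ - ε • y := by simp [c', h23]
  have hc3 : c' j₃ = c j₁ - ε • z := by simp [c']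
  have hci : ∀ i, i ≠ j₁ → i ≠ j₂ → i ≠ j₃ → c' i = c i := by
    intro i h1 h2 h3
    simp [c', h1, h2, h3]
  refine ⟨c', ?_, K.eq_span_of_span_le hK ?_⟩
  · intro i
    by_cases h1 : i = j₁
    · subst h1
      rw [hc1]
      exact add_mem hb1 (smul_mem _ _ hx)
    by_cases h2 : i = j₂
    · subst h2
      rw [hc2]
      exact sub_mem hb2 (smul_mem _ _ hy)
    by_cases h3 : i = j₃
    · subst h3
      rw [hc3]
      exact sub_mem hb3 (smul_mem _ _ hz)
    · rw [hci i h1 h2 h3]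
      exact h4 i h1 h2 h3
  · intro i
    have hmem : ∀ i, c' i ∈ span ℂ (Set.range c') := fun i => subset_span ⟨i, rfl⟩
    by_cases h1 : i = j₁
    · subst h1
      simp only [Function.update_self]
      rw [← hc1]
      exact hmem _
    rw [Function.update_of_ne h1]
    -- Differences of the new vectors recover first `c j₂`, then `c j₂ + μ c j₃`, and hence `c j₃`
    -- since `μ ≠ 0`.
    have e2 : c j₂ = ε⁻¹ • (c' j₁ - c' j₂) := by
      rw [hc1, hc2, ← hxy, eq_inv_smul_iff₀ hε]
      module
    by_cases h2 : i = j₂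
    · subst h2
      rw [e2]
      exact smul_mem _ _ (sub_mem (hmem _) (hmem _))
    by_cases h3 : i = j₃
    · subst h3
      have e3 : c i = μ⁻¹ • (ε⁻¹ • (c' j₁ - c' i) - ε⁻¹ • (c' j₁ - c' j₂)) := by
        rw [← e2, hc1, hc3, eq_inv_smul_iff₀ hμ, eq_sub_iff_add_eq, eq_inv_smul_iff₀ hε, add_comm,
          ← hxz]
        module
      rw [e3]
      exact smul_mem _ _ (sub_mem (smul_mem _ _ (sub_mem (hmem _) (hmem _)))
        (smul_mem _ _ (sub_mem (hmem _) (hmem _))))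
    · rw [← hci i h1 h2 h3]
      exact hmem _

/-! ### Coordinate subspaces -/

/-- The span of the standard basis vectors indexed by `I`. -/
def coordSubspace (I : Set (Fin n)) : Submodule ℂ (Fin n → ℂ) where
  carrier := {v | ∀ i, i ∉ I → v i = 0}
  add_mem' := by
    intro v w hv hw i hi
    simp [hv i hi, hw i hi]
  zero_mem' := by
    intro i _
    rfl
  smul_mem' := by
    intro z v hv i hi
    simp [hv i hi]

theorem coordSubspace_mono {I J : Set (Fin n)} (h : I ⊆ J) : coordSubspace I ≤ coordSubspace J :=
  fun _ hv i hi => hv i fun hI => hi (h hI)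

theorem coordSubspace_le_sup {I J K : Set (Fin n)} (h : I ⊆ J ∪ K) :
    coordSubspace I ≤ coordSubspace J ⊔ coordSubspace K := by
  classical
  intro v hv
  refine mem_sup.2 ⟨fun i => if i ∈ J then v i else 0, ?_, fun i => if i ∈ J then 0 else v i, ?_, ?_⟩
  · intro i hi
    simp [hi]
  · intro i hi
    by_cases hJ : i ∈ J
    · simp [hJ]
    · have : i ∉ I := fun hI => (h hI).elim hJ hi
      simp [hJ, hv i this]
  · ext i
    by_cases hJ : i ∈ J <;> simp [hJ]

theorem exists_mem_of_mem_coordSubspace {I : Set (Fin n)} {v : Fin n → ℂ} (hv : v ∈ coordSubspace I)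
    (h0 : v ≠ 0) : ∃ i, i ∈ I := by
  by_contra! h
  exact h0 (funext fun i => hv i (h i))

theorem coordSubspace_eq_span (I : Set (Fin n)) :
    coordSubspace I = span ℂ {v | ∃ i ∈ I, v = Pi.single i 1} := by
  apply le_antisymm
  · intro v hv
    rw [pi_eq_sum_univ' v]
    refine sum_mem fun i _ => ?_
    by_cases hi : i ∈ I
    · exact smul_mem _ _ (subset_span ⟨i, hi, by ext l; simp [Pi.single_apply, eq_comm]⟩)
    · rw [hv i hi, zero_smul]
      exact zero_mem _
  · rw [span_le]
    rintro _ ⟨i, hi, rfl⟩ l hl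
    rw [Pi.single_eq_of_ne]
    rintro rfl
    exact hl hi

/-! ### The action of linear automorphisms on the Grassmannian -/

/-- The image of a subspace under a linear automorphism. -/
def Gr.map (e : (Fin n → ℂ) ≃ₗ[ℂ] (Fin n → ℂ)) (H : Gr k n) : Gr k n :=
  ⟨H.1.map (e : (Fin n → ℂ) →ₗ[ℂ] (Fin n → ℂ)), by
    rw [LinearEquiv.finrank_map_eq, H.2]⟩

theorem Matrix.span_col_mul (N : Matrix (Fin n) (Fin n) ℂ) (A : Matrix (Fin n) (Fin k) ℂ) :
    span ℂ (Set.range (N * A).col) = (span ℂ (Set.range A.col)).map N.mulVecLin := by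
  rw [Submodule.map_span, ← Set.range_comp]
  rfl

/-- On the Stiefel manifold the action lifts to left multiplication by a matrix, and the
Grassmannian carries the quotient topology. -/
theorem Gr.continuous_map (e : (Fin n → ℂ) ≃ₗ[ℂ] (Fin n → ℂ)) :
    Continuous (Gr.map e : Gr k n → Gr k n) := by
  obtain ⟨N, hN⟩ : ∃ N : Matrix (Fin n) (Fin n) ℂ,
      N.mulVecLin = (e : (Fin n → ℂ) →ₗ[ℂ] (Fin n → ℂ)) :=
    ⟨LinearMap.toMatrix' (e : (Fin n → ℂ) →ₗ[ℂ] (Fin n → ℂ)), Matrix.toLin'_toMatrix' _⟩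
  have hrank : ∀ A : Stiefel k n, (N * A.1).rank = k := by
    intro A
    rw [Matrix.rank_eq_finrank_span_cols, Matrix.span_col_mul, hN]
    exact (Gr.map e (columnSpan A)).2
  have hcont : Continuous fun A : Stiefel k n => (⟨N * A.1, hrank A⟩ : Stiefel k n) := by
    apply Continuous.subtype_mk
    exact Continuous.matrix_mul continuous_const continuous_subtype_val
  have heq : ∀ A : Stiefel k n, Gr.map e (columnSpan A) = columnSpan ⟨N * A.1, hrank A⟩ := by
    intro A
    apply Subtype.ext
    have h := Matrix.span_col_mul N A.1
    rw [hN] at h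
    exact h.symm
  have hspan : Continuous (columnSpan : Stiefel k n → Gr k n) := continuous_coinduced_rng
  refine continuous_coinduced_dom.2 ?_
  exact (hspan.comp hcont).congr fun A => (heq A).symm

theorem Gr.map_symm_map (e : (Fin n → ℂ) ≃ₗ[ℂ] (Fin n → ℂ)) (H : Gr k n) :
    Gr.map e (Gr.map e.symm H) = H := by
  apply Subtype.ext
  change (H.1.map _).map _ = H.1
  rw [← Submodule.map_comp]
  simp

theorem Gr.map_mem_closure {e : (Fin n → ℂ) ≃ₗ[ℂ] (Fin n → ℂ)} {H : Gr k n}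
    {V : Fin k → Submodule ℂ (Fin n → ℂ)} (h : Gr.map e.symm H ∈ closure (transversalSpans V)) :
    H ∈ closure (transversalSpans fun j =>
      (V j).map (e : (Fin n → ℂ) →ₗ[ℂ] (Fin n → ℂ))) := by
  rw [← Gr.map_symm_map e H]
  refine _root_.map_mem_closure (Gr.continuous_map e) h ?_
  rintro K ⟨c, hc, hs⟩
  refine ⟨fun j => e (c j), fun j => Submodule.mem_map_of_mem (hc j), ?_⟩
  change _ = K.1.map _
  rw [← hs, Submodule.map_span, ← Set.range_comp]
  rfl

end Grassmannian

/-! ## Flags in a vector space -/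

section Flags

open Module (finrank)

variable {E : Type*} [AddCommGroup E] [Module ℂ E] [FiniteDimensional ℂ E]

theorem Submodule.eq_sup_span_of_finrank_le {A B : Submodule ℂ E} (hAB : A ≤ B)
    (h : finrank ℂ B ≤ finrank ℂ A + 1) {v : E} (hv : v ∈ B) (hvA : v ∉ A) :
    A ⊔ Submodule.span ℂ {v} = B := by
  apply Submodule.eq_of_le_of_finrank_le
  · exact sup_le hAB ((Submodule.span_singleton_le_iff_mem _ _).2 hv)
  · refine h.trans (Submodule.finrank_lt_finrank_of_lt ?_)
    refine lt_of_le_of_ne le_sup_left fun h' => hvA ?_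
    rw [h']
    exact Submodule.mem_sup_right (Submodule.mem_span_singleton_self v)

theorem Submodule.exists_between_finrank_eq {A B : Submodule ℂ E} (hAB : A ≤ B) {m : ℕ}
    (h1 : finrank ℂ A ≤ m) (h2 : m ≤ finrank ℂ B) :
    ∃ C, A ≤ C ∧ C ≤ B ∧ finrank ℂ C = m := by
  induction m, h1 using Nat.le_induction with
  | base => exact ⟨A, le_rfl, hAB, rfl⟩
  | succ m _ ih =>
    obtain ⟨C, hAC, hCB, hC⟩ := ih (by omega)
    have hlt : C < B := lt_of_le_of_ne hCB (by rintro rfl; omega)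
    obtain ⟨v, hvB, hvC⟩ := SetLike.exists_of_lt hlt
    refine ⟨C ⊔ Submodule.span ℂ {v}, hAC.trans le_sup_left,
      sup_le hCB ((Submodule.span_singleton_le_iff_mem _ _).2 hvB), ?_⟩
    have hv : v ≠ 0 := by
      rintro rfl
      exact hvC (zero_mem _)
    have e1 := Submodule.finrank_add_le_finrank_add_finrank C (Submodule.span ℂ {v})
    rw [finrank_span_singleton hv, hC] at e1
    have e2 : finrank ℂ C < finrank ℂ (C ⊔ Submodule.span ℂ {v} : Submodule ℂ E) := by
      refine Submodule.finrank_lt_finrank_of_lt (lt_of_le_of_ne le_sup_left fun h' => hvC ?_)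
      rw [h']
      exact Submodule.mem_sup_right (Submodule.mem_span_singleton_self v)
    omega

/-- A chain of subspaces with prescribed dimensions between two given chains. -/
theorem Submodule.exists_chain_between {N Y : ℕ → Submodule ℂ E} {f : ℕ → ℕ} (hN : Monotone N)
    (hY : Monotone Y) (hYN : ∀ i, Y i ≤ N i) (hf : ∀ i, f i ≤ finrank ℂ (N i))
    (hf0 : f 0 = 0) (hY0 : Y 0 = ⊥)
    (hYf : ∀ i, finrank ℂ (Y (i + 1)) + f i ≤ finrank ℂ (Y i) + f (i + 1)) :
    ∃ Z : ℕ → Submodule ℂ E, Monotone Z ∧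
      ∀ i, Y i ≤ Z i ∧ Z i ≤ N i ∧ finrank ℂ (Z i) = f i := by
  let P : ℕ → Type _ := fun i => {C : Submodule ℂ E // Y i ≤ C ∧ C ≤ N i ∧ finrank ℂ C = f i}
  have step : ∀ i (C : P i), ∃ C' : P (i + 1), C.1 ≤ C'.1 := by
    rintro i ⟨C, h1, h2, h3⟩
    -- The next space must contain `C + Y (i + 1)`. Since `C ∩ Y (i + 1)` contains `Y i`, this sum
    -- has dimension at most `f i + dim Y (i + 1) - dim Y i ≤ f (i + 1)`.
    have hinf : finrank ℂ (Y i) ≤ finrank ℂ (C ⊓ Y (i + 1) : Submodule ℂ E) :=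
      Submodule.finrank_mono (le_inf h1 (hY (Nat.le_succ i)))
    have hsum := Submodule.finrank_sup_add_finrank_inf_eq C (Y (i + 1))
    have hYi := hYf i
    obtain ⟨C', e1, e2, e3⟩ := Submodule.exists_between_finrank_eq
      (sup_le (h2.trans (hN (Nat.le_succ i))) (hYN (i + 1))) (m := f (i + 1)) (by omega) (hf _)
    exact ⟨⟨C', le_sup_right.trans e1, e2, e3⟩, le_sup_left.trans e1⟩
  choose g hg using step
  let z : ∀ i, P i := fun i => Nat.rec
    ⟨⊥, by rw [hY0], bot_le, by rw [hf0, finrank_bot]⟩ (fun i C => g i C) i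
  refine ⟨fun i => (z i).1, monotone_nat_of_le_succ fun i => hg i (z i), fun i => (z i).2⟩

theorem Submodule.finrank_inf_le_add_one {A A' : Submodule ℂ E} (h : A ≤ A')
    (hd : finrank ℂ A' ≤ finrank ℂ A + 1) (Z : Submodule ℂ E) :
    finrank ℂ (A' ⊓ Z : Submodule ℂ E) ≤ finrank ℂ (A ⊓ Z : Submodule ℂ E) + 1 := by
  have h1 := Submodule.finrank_sup_add_finrank_inf_eq (A' ⊓ Z) A
  have h2 : finrank ℂ (A' ⊓ Z ⊔ A : Submodule ℂ E) ≤ finrank ℂ A' :=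
    Submodule.finrank_mono (sup_le inf_le_left h)
  have h3 : finrank ℂ (A' ⊓ Z ⊓ A : Submodule ℂ E) ≤ finrank ℂ (A ⊓ Z : Submodule ℂ E) :=
    Submodule.finrank_mono (le_inf inf_le_right (inf_le_left.trans inf_le_right))
  omega

/-- Two flags have a common adapted basis.  The second flag has its jumps at the values of `κ`. -/
theorem Submodule.exists_adapted_basis {k : ℕ} {X Z : ℕ → Submodule ℂ E} (hX : Monotone X)
    (hXd : ∀ j ≤ k, finrank ℂ (X j) = j) (hZ : Monotone Z) {κ : Fin k → ℕ}
    (hκ : Function.Injective κ)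
    (hZd : ∀ m, finrank ℂ (Z m) = (Finset.univ.filter fun j => κ j < m).card)
    {K : ℕ} (hK : X k ≤ Z K) :
    ∃ (τ : Equiv.Perm (Fin k)) (b : Fin k → E),
      (∀ j : Fin k, b j ∈ X (j + 1) ∧ b j ∈ Z (κ (τ j) + 1)) ∧
      X k ≤ Submodule.span ℂ (Set.range b) ∧
      ∀ m, ∀ j ≤ k, finrank ℂ (X j ⊓ Z m : Submodule ℂ E) ≤
        (Finset.univ.filter fun i : Fin k => i.val < j ∧ κ (τ i) < m).card := by
  classical
  -- The basis vector `b j` is taken in `X (j + 1)` outside `X j`, as early in the flag `Z` as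
  -- possible. The first possible place is a jump of `Z`, which defines `t j`.
  have hex : ∀ j : Fin k, ∃ m, ∃ v ∈ X (j + 1) ⊓ Z m, v ∉ X j := by
    intro j
    have hlt : X j < X (j + 1) := by
      refine lt_of_le_of_ne (hX (Nat.le_succ _)) fun h => ?_
      have h1 := hXd j j.2.le
      rw [h, hXd (j + 1) j.2] at h1
      omega
    obtain ⟨v, hv, hv'⟩ := SetLike.exists_of_lt hlt
    exact ⟨K, v, ⟨hv, hK (hX j.2 hv)⟩, hv'⟩
  have hZ0 : Z 0 = ⊥ := by
    rw [← Submodule.finrank_eq_zero (R := ℂ), hZd]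
    simp
  have hZs : ∀ m, finrank ℂ (Z (m + 1)) ≤ finrank ℂ (Z m) + 1 := by
    intro m
    rw [hZd, hZd]
    have hsub : (Finset.univ.filter fun j => κ j < m + 1) ⊆
        (Finset.univ.filter fun j => κ j < m) ∪ Finset.univ.filter fun j => κ j = m := by
      intro j
      simp only [Finset.mem_filter, Finset.mem_univ, true_and, Finset.mem_union]
      omega
    refine (Finset.card_le_card hsub).trans ((Finset.card_union_le _ _).trans ?_)
    gcongr
    rw [Finset.card_le_one]
    intro i hi j hj
    simp only [Finset.mem_filter, Finset.mem_univ, true_and] at hi hj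
    exact hκ (hi.trans hj.symm)
  have hjump : ∀ j : Fin k, ∃ i, κ i + 1 = Nat.find (hex j) := by
    intro j
    obtain ⟨v, hv, hvX⟩ := Nat.find_spec (hex j)
    obtain ⟨m, hm⟩ : ∃ m, Nat.find (hex j) = m + 1 := by
      refine Nat.exists_eq_succ_of_ne_zero fun h0 => hvX ?_
      rw [h0, hZ0] at hv
      rw [(Submodule.mem_bot ℂ).1 hv.2]
      exact zero_mem _
    by_contra! hno
    have hle : Z (m + 1) ≤ Z m := by
      refine (Submodule.eq_of_le_of_finrank_le (hZ (Nat.le_succ m)) ?_).ge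
      rw [hZd, hZd]
      apply Finset.card_le_card
      intro i
      simp only [Finset.mem_filter, Finset.mem_univ, true_and]
      have := hno i
      omega
    refine Nat.find_min (hex j) (m := m) (by omega) ⟨v, ⟨hv.1, hle ?_⟩, hvX⟩
    rw [← hm]
    exact hv.2
  choose t ht using hjump
  have hspec : ∀ j : Fin k, ∃ v ∈ X (j + 1) ⊓ Z (κ (t j) + 1), v ∉ X j := by
    intro j
    rw [ht j]
    exact Nat.find_spec (hex j)
  have hmin : ∀ (j : Fin k) m, m ≤ κ (t j) → ∀ v ∈ X (j + 1) ⊓ Z m, v ∈ X j := by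
    intro j m hm v hv
    by_contra h
    refine Nat.find_min (hex j) (m := m) ?_ ⟨v, hv, h⟩
    rw [← ht j]
    omega
  choose b hb hbX using hspec
  have hinj : Function.Injective t := by
    -- At a common jump, `b j'` minus a multiple of `b j` would lie one step earlier in `Z`, hence
    -- in `X j'` by minimality, and then so would `b j'`.
    have aux : ∀ j j' : Fin k, j < j' → t j ≠ t j' := by
      intro j j' hlt heq
      have hbZ : b j ∉ Z (κ (t j)) := fun h => hbX j (hmin j _ le_rfl _ ⟨(hb j).1, h⟩)
      have hsup := Submodule.eq_sup_span_of_finrank_le (hZ (Nat.le_succ (κ (t j)))) (hZs _)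
        (hb j).2 hbZ
      have hb' : b j' ∈ Z (κ (t j) + 1) := by
        rw [heq]
        exact (hb j').2
      rw [Nat.succ_eq_add_one] at hsup
      rw [← hsup, Submodule.mem_sup] at hb'
      obtain ⟨z, hz, w, hw, hzw⟩ := hb'
      have hwX : w ∈ X j' := by
        obtain ⟨x, rfl⟩ := Submodule.mem_span_singleton.1 hw
        exact Submodule.smul_mem _ _ (hX (Nat.succ_le_of_lt hlt) (hb j).1)
      have hzeq : z = b j' - w := eq_sub_of_add_eq hzw
      have hzX : z ∈ X j' := by
        refine hmin j' (κ (t j)) (by rw [heq]) z ⟨?_, hz⟩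
        rw [hzeq]
        exact sub_mem (hb j').1 (hX (Nat.le_succ _) hwX)
      apply hbX j'
      rw [← hzw]
      exact add_mem hzX hwX
    intro j j' h
    by_contra hne
    rcases lt_or_gt_of_ne hne with h' | h'
    · exact aux _ _ h' h
    · exact aux _ _ h' h.symm
  refine ⟨Equiv.ofBijective t (Finite.injective_iff_bijective.1 hinj), b, fun j => hb j, ?_, ?_⟩
  · have hle : ∀ j ≤ k, X j ≤ Submodule.span ℂ (Set.range b) := by
      intro j
      induction j with
      | zero =>
        intro _
        have : X 0 = ⊥ := by
          rw [← Submodule.finrank_eq_zero (R := ℂ), hXd 0 (Nat.zero_le _)]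
        rw [this]
        exact bot_le
      | succ j ih =>
        intro hj
        rw [← Submodule.eq_sup_span_of_finrank_le (hX (Nat.le_succ j))
          (by rw [Nat.succ_eq_add_one, hXd _ hj, hXd j (by omega)]) (hb ⟨j, hj⟩).1 (hbX ⟨j, hj⟩)]
        exact sup_le (ih (by omega))
          ((Submodule.span_singleton_le_iff_mem _ _).2 (Submodule.subset_span ⟨_, rfl⟩))
    exact hle k le_rfl
  · intro m j
    simp only [Equiv.ofBijective_apply]
    induction j with
    | zero =>
      intro _
      have : X 0 = ⊥ := by
        rw [← Submodule.finrank_eq_zero (R := ℂ), hXd 0 (Nat.zero_le _)]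
      simp [this]
    | succ j ih =>
      intro hj
      have ih := ih (by omega)
      -- Passing from `X j` to `X (j + 1)` raises the dimension of the intersection with `Z m` by at
      -- most one, and not at all before the jump of index `t j`.
      by_cases hm : κ (t ⟨j, hj⟩) < m
      · refine (Submodule.finrank_inf_le_add_one (hX (Nat.le_succ j))
          (by rw [Nat.succ_eq_add_one, hXd _ hj, hXd j (by omega)]) (Z m)).trans ?_
        refine (Nat.add_le_add_right ih 1).trans ?_
        rw [← Finset.card_insert_of_notMem (a := (⟨j, hj⟩ : Fin k)) (by simp)]
        apply Finset.card_le_card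
        intro i
        simp only [Finset.mem_insert, Finset.mem_filter, Finset.mem_univ, true_and]
        rintro (rfl | hi)
        · exact ⟨Nat.lt_succ_self j, hm⟩
        · exact ⟨by omega, hi.2⟩
      · have hle : X (j + 1) ⊓ Z m ≤ X j ⊓ Z m := fun v hv =>
          ⟨hmin ⟨j, hj⟩ m (by omega) v hv, hv.2⟩
        refine (Submodule.finrank_mono hle).trans (ih.trans (Finset.card_le_card ?_))
        intro i
        simp only [Finset.mem_filter, Finset.mem_univ, true_and]
        exact fun hi => ⟨by omega, hi.2⟩

end Flags

/-! ### Generic transversals. -/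

section Perturbation

open Filter
open Submodule (span subset_span span_le mem_sup smul_mem)

variable {k n : ℕ}

theorem eventually_add_mul_ne_zero (z : ℂ) : ∀ᶠ ε in 𝓝[≠] (0 : ℂ), z + ε ≠ 0 := by
  by_cases hz : z = 0
  · filter_upwards [eventually_ne_zero] with ε hε
    simpa [hz] using hε
  · have hc : ContinuousAt (fun ε : ℂ => z + ε) 0 := by fun_prop
    exact (hc.eventually_ne (by simpa using hz)).filter_mono nhdsWithin_le_nhds

/-- Transversals can be chosen outside given hyperplanes that do not contain the subspaces. -/
theorem transversalSpans_subset_closure_generic {V : Fin k → Submodule ℂ (Fin n → ℂ)}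
    (u : Fin k → Fin n → ℂ) (hu : ∀ j, u j ∈ V j) (ℓ : Fin k → (Fin n → ℂ) →ₗ[ℂ] ℂ) :
    transversalSpans V ⊆ closure {H : Gr k n | ∃ c : Fin k → Fin n → ℂ, (∀ j, c j ∈ V j) ∧
      span ℂ (Set.range c) = H.1 ∧ ∀ j, ℓ j (u j) = 1 → ℓ j (c j) ≠ 0} := by
  rintro H ⟨c, hc, hs⟩
  refine Gr.mem_closure_of_path (fun ε j => c j + ε • u j) ?_ (by simpa using hs) ?_
  · apply Continuous.continuousAt
    fun_prop
  · have h : ∀ᶠ ε in 𝓝[≠] (0 : ℂ), ∀ j, ℓ j (c j) + ε ≠ 0 :=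
      eventually_all.2 fun j => eventually_add_mul_ne_zero _
    filter_upwards [h] with ε hε K hK
    refine ⟨_, fun j => add_mem (hc j) (smul_mem _ ε (hu j)), hK.symm, fun j hj => ?_⟩
    rw [map_add, map_smul, hj, smul_eq_mul, mul_one]
    exact hε j

end Perturbation

/-! ## Staircases of intervals

The index sets `{i | black checker of row i is northwest of the j-th red checker}` on a board of
the checkerboard game are of two kinds: intervals, and initial segments of `[s, n)` without the
critical row `q`. -/

/-- Index sets `[A j, row j]` for the indices `j` that are not `left`, and `[s, row j] \ {q}` for
the others. -/
structure Staircase (k n : ℕ) where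
  row : Fin k → Fin n
  left : Fin k → Prop
  A : Fin k → ℕ
  s : ℕ
  q : Fin n
  row_strictMono : StrictMono row
  s_le_q : s ≤ q
  A_le : ∀ j, ¬ left j → A j ≤ s
  A_mono : ∀ j j', ¬ left j → ¬ left j' → j < j' → A j ≤ A j'

namespace Staircase

open Submodule (span subset_span span_le mem_sup smul_mem)
open Module (finrank)
open scoped Classical

variable {k n : ℕ} (C : Staircase k n)

def colSet (j : Fin k) : Set (Fin n) :=
  {i | (C.left j → C.s ≤ i ∧ i ≠ C.q) ∧ (¬ C.left j → C.A j ≤ i)}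

def indexSet (j : Fin k) : Set (Fin n) := {i | i ≤ C.row j ∧ i ∈ C.colSet j}

/-- The union of the index sets of all `j₀ ≤ j` contains `q` exactly under this condition, which is
why it enters the row bound of `j`. -/
def HasCritical (j : Fin k) : Prop := ∃ j₀ ≤ j, ¬ C.left j₀ ∧ C.q ≤ C.row j₀

def rowSet (j : Fin k) : Set (Fin n) := {i | i ≤ C.row j ∧ (i = C.q → C.HasCritical j)}

/-- The row bounds of `j` combined with the column bounds of `τ j`. -/
def cell (τ : Equiv.Perm (Fin k)) (j : Fin k) : Set (Fin n) := C.rowSet j ∩ C.colSet (τ j)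

def cellSpans (τ : Equiv.Perm (Fin k)) : Set (Gr k n) :=
  transversalSpans fun j => coordSubspace (C.cell τ j)

/-- The number of indices below `m` whose column bounds are those of a left index. -/
noncomputable def leftCount (τ : Equiv.Perm (Fin k)) (m : ℕ) : ℕ :=
  (Finset.univ.filter fun i : Fin k => i.val < m ∧ C.left (τ i)).card

/-- The left column bounds come at least as early under `τ` as in the given order. Exchanges only
have to move them to later positions. -/
def Dominates (τ : Equiv.Perm (Fin k)) : Prop := ∀ m ≤ k, C.leftCount 1 m ≤ C.leftCount τ m

theorem HasCritical.mono {C : Staircase k n} {j j' : Fin k} (h : C.HasCritical j) (hj : j ≤ j') :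
    C.HasCritical j' := by
  obtain ⟨j₀, h1, h2⟩ := h
  exact ⟨j₀, h1.trans hj, h2⟩

theorem rowSet_mono {j j' : Fin k} (h : j ≤ j') : C.rowSet j ⊆ C.rowSet j' := fun _ hi =>
  ⟨hi.1.trans (C.row_strictMono.monotone h), fun hq => (hi.2 hq).mono h⟩

theorem indexSet_subset_rowSet {j j' : Fin k} (h : j ≤ j') : C.indexSet j ⊆ C.rowSet j' := by
  intro i hi
  refine C.rowSet_mono h ⟨hi.1, fun hq => ?_⟩
  by_cases hl : C.left j
  · exact absurd hq (hi.2.1 hl).2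
  · exact ⟨j, le_rfl, hl, hq ▸ hi.1⟩

theorem cell_subset_indexSet {τ : Equiv.Perm (Fin k)} {j : Fin k}
    (hl : C.left (τ j) ↔ C.left j) (h : ¬ C.left j → τ j = j) : C.cell τ j ⊆ C.indexSet j := by
  rintro i ⟨hi, hc⟩
  refine ⟨hi.1, fun hj => hc.1 (hl.2 hj), fun hj => ?_⟩
  have := hc.2 (by rwa [hl])
  rwa [h hj] at this

theorem colSet_subset_of_left {j j' : Fin k} (hj : C.left j) (hj' : ¬ C.left j') :
    C.colSet j ⊆ C.colSet j' := fun _ hi =>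
  ⟨fun h => absurd h hj', fun _ => (C.A_le _ hj').trans (hi.1 hj).1⟩

theorem colSet_subset_of_lt {j j' : Fin k} (hj : ¬ C.left j) (hj' : ¬ C.left j') (h : j' < j) :
    C.colSet j ⊆ C.colSet j' := fun _ hi =>
  ⟨fun h => absurd h hj', fun _ => (C.A_mono _ _ hj' hj h).trans (hi.2 hj)⟩

theorem colSet_subset_of_left_left {j j' : Fin k} (hj : C.left j) (hj' : C.left j') :
    C.colSet j ⊆ C.colSet j' := fun _ hi =>
  ⟨fun _ => hi.1 hj, fun h => absurd hj' h⟩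

/-! ### A transversal basis for some rearrangement of the column bounds -/

/-- The position of the column bounds of `j` in their order by inclusion. -/
noncomputable def key (j : Fin k) : ℕ := if C.left j then j else 2 * k - 1 - j

/-- Left indices keep their position as key, whereas the keys of the others are at least `k`. The
first `k` steps of the column flag therefore only involve left indices, in their row order. -/
theorem key_lt_iff (j : Fin k) {m : ℕ} (hm : m ≤ k) :
    C.key j < m ↔ j.val < m ∧ C.left j := by
  unfold key
  have := j.2
  split_ifs with h
  · simp [h]
  · simp only [h, and_false, iff_false]
    omega

theorem key_lt (j : Fin k) : C.key j < 2 * k := by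
  unfold key
  have := j.2
  split_ifs <;> omega

theorem key_injective : Function.Injective C.key := by
  intro i j h
  unfold key at h
  have := i.2
  have := j.2
  ext
  split_ifs at h <;> omega

theorem colSet_subset_of_key_le {j j' : Fin k} (h : C.key j ≤ C.key j') :
    C.colSet j ⊆ C.colSet j' := by
  by_cases hj : C.left j <;> by_cases hj' : C.left j'
  · exact C.colSet_subset_of_left_left hj hj'
  · exact C.colSet_subset_of_left hj hj'
  · simp only [key, hj, hj', if_true, if_false] at h
    omega
  · simp only [key, hj, hj', if_false] at h
    rcases lt_trichotomy j' j with h' | rfl | h'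
    · exact C.colSet_subset_of_lt hj hj' h'
    · exact le_rfl
    · have := j'.2
      rw [Fin.lt_def] at h'
      omega

/-- The rank conditions defining a checkerboard variety. -/
def rankVariety : Set (Gr k n) :=
  {H | ∀ S : Finset (Fin k), S.card ≤
    finrank ℂ (H.1 ⊓ coordSubspace {i | ∃ j ∈ S, i ∈ C.indexSet j} : Submodule ℂ (Fin n → ℂ))}

/-- The rank conditions leave room in `H` for a flag `Z` that follows the column bounds in the order
of `key`, and for a flag `X` that follows the row bounds. A basis adapted to both satisfies the row
bound of `j` and the column bound of `τ j`. Choosing `X m ⊇ Z m` for `m ≤ k` gives `dim Z m ≤ dim (X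
m ∩ Z k)`, and counting basis vectors turns this into domination. -/
theorem exists_mem_cellSpans {H : Gr k n} (hH : H ∈ C.rankVariety) :
    ∃ τ, H ∈ C.cellSpans τ ∧ C.Dominates τ := by
  let N : (Fin k → ℕ) → ℕ → Submodule ℂ (Fin n → ℂ) := fun f m =>
    H.1 ⊓ coordSubspace {i | ∃ j ∈ Finset.univ.filter fun j => f j < m, i ∈ C.indexSet j}
  have hNmono : ∀ f, Monotone (N f) := by
    intro f m m' hm
    refine inf_le_inf_left _ (coordSubspace_mono ?_)
    rintro i ⟨j, hj, hi⟩
    simp only [Finset.mem_filter, Finset.mem_univ, true_and] at hj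
    exact ⟨j, by simpa using hj.trans_le hm, hi⟩
  have hstep : ∀ m, (Finset.univ.filter fun j => C.key j < m + 1).card ≤
      (Finset.univ.filter fun j => C.key j < m).card + 1 := by
    intro m
    have hsub : (Finset.univ.filter fun j => C.key j < m + 1) ⊆
        (Finset.univ.filter fun j => C.key j < m) ∪ Finset.univ.filter fun j => C.key j = m := by
      intro j
      simp only [Finset.mem_filter, Finset.mem_univ, true_and, Finset.mem_union]
      omega
    refine (Finset.card_le_card hsub).trans ((Finset.card_union_le _ _).trans ?_)
    gcongr
    rw [Finset.card_le_one]
    intro i hi j hj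
    simp only [Finset.mem_filter, Finset.mem_univ, true_and] at hi hj
    exact C.key_injective (hi.trans hj.symm)
  have hcard : ∀ m ≤ k, (Finset.univ.filter fun j : Fin k => j.val < m).card = m := by
    intro m hm
    rw [Fin.card_filter_val_lt, min_eq_right hm]
  obtain ⟨Z, hZ, hZ'⟩ := Submodule.exists_chain_between (N := N C.key) (Y := fun _ => ⊥)
    (f := fun m => (Finset.univ.filter fun j => C.key j < m).card) (hNmono _) (fun _ _ _ => le_rfl)
    (fun _ => bot_le) (fun m => hH _) (by simp) rfl
    (by
      intro m
      rw [add_comm, add_comm (finrank ℂ _)]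
      gcongr
      exact Nat.le_succ m)
  have hZk : ∀ m ≤ k, Z m ≤ N (fun j => j.val) m := by
    intro m hm
    refine (hZ' m).2.1.trans (inf_le_inf_left _ (coordSubspace_mono ?_))
    rintro i ⟨j, hj, hi⟩
    simp only [Finset.mem_filter, Finset.mem_univ, true_and] at hj
    exact ⟨j, by simpa using ((C.key_lt_iff j hm).1 hj).1, hi⟩
  have hZ0 : Z 0 = ⊥ := by
    rw [← Submodule.finrank_eq_zero (R := ℂ), (hZ' 0).2.2]
    simp
  -- The lower chain stops at `Z k`, since the later spaces of `Z` involve non-left indices and need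
  -- not lie in `X m`.
  obtain ⟨X, hX, hX'⟩ := Submodule.exists_chain_between (N := N fun j => j.val)
    (Y := fun m => Z (min m k)) (f := fun m => min m k) (hNmono _)
    (fun m m' h => hZ (min_le_min_right k h))
    (fun m => (hZk _ (min_le_right _ _)).trans (hNmono _ (min_le_left _ _)))
    (fun m => by
      have h := (hH (Finset.univ.filter fun j : Fin k => j.val < min m k)).trans
        (Submodule.finrank_mono (hNmono (fun j => j.val) (min_le_left m k)))
      rwa [hcard _ (min_le_right _ _)] at h)
    (by simp) (by simpa using hZ0)
    (by
      intro m
      have h := hstep (min m k)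
      rcases lt_or_ge m k with hm | hm
      · rw [min_eq_left hm.le, min_eq_left (show m + 1 ≤ k from hm), (hZ' _).2.2, (hZ' _).2.2]
        rw [min_eq_left hm.le] at h
        omega
      · rw [min_eq_right hm, min_eq_right (hm.trans (Nat.le_succ m))])
  have hXd : ∀ j ≤ k, finrank ℂ (X j) = j := by
    intro j hj
    rw [(hX' j).2.2, min_eq_left hj]
  have hXk : X k = H.1 :=
    Submodule.eq_of_le_of_finrank_eq ((hX' k).2.1.trans inf_le_left) (by rw [hXd k le_rfl, H.2])
  have hZH : Z (2 * k) = H.1 := by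
    refine Submodule.eq_of_le_of_finrank_eq ((hZ' _).2.1.trans inf_le_left) ?_
    rw [(hZ' _).2.2, H.2, Finset.filter_true_of_mem fun j _ => C.key_lt j, Finset.card_univ,
      Fintype.card_fin]
  obtain ⟨τ, b, hb, hspan, hdim⟩ := Submodule.exists_adapted_basis hX hXd hZ C.key_injective
    (fun m => (hZ' m).2.2) (K := 2 * k) (by rw [hXk, hZH])
  refine ⟨τ, ⟨b, fun j i hi => ?_, ?_⟩, ?_⟩
  · obtain ⟨h1, h2⟩ := hb j
    by_cases hr : i ∈ C.rowSet j
    · refine ((hZ' _).2.1 h2).2 i fun ⟨j', hj', hi'⟩ => hi ⟨hr, ?_⟩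
      simp only [Finset.mem_filter, Finset.mem_univ, true_and] at hj'
      exact C.colSet_subset_of_key_le (Nat.lt_succ_iff.1 hj') hi'.2
    · refine ((hX' _).2.1 h1).2 i fun ⟨j', hj', hi'⟩ => hr ?_
      simp only [Finset.mem_filter, Finset.mem_univ, true_and] at hj'
      exact C.indexSet_subset_rowSet (Nat.lt_succ_iff.1 hj') hi'
  · rw [hXk] at hspan
    refine (Submodule.eq_of_le_of_finrank_le hspan ?_).symm
    rw [H.2]
    exact (finrank_range_le_card (R := ℂ) b).trans_eq (Fintype.card_fin k)
  · intro m hm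
    have h1 := hdim k m hm
    have h2 : finrank ℂ (Z m) ≤ finrank ℂ (X m ⊓ Z k : Submodule ℂ (Fin n → ℂ)) := by
      refine Submodule.finrank_mono (le_inf ?_ (hZ hm))
      have := (hX' m).1
      rwa [min_eq_left hm] at this
    rw [(hZ' m).2.2] at h2
    have e1 : C.leftCount 1 m = (Finset.univ.filter fun j => C.key j < m).card := by
      unfold leftCount
      congr 1
      ext j
      rw [Finset.mem_filter, Finset.mem_filter, C.key_lt_iff j hm]
      rfl
    have e2 : C.leftCount τ m =
        (Finset.univ.filter fun i : Fin k => i.val < m ∧ C.key (τ i) < k).card := by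
      unfold leftCount
      congr 1
      ext j
      simp [C.key_lt_iff (τ j) le_rfl]
    rw [e1, e2]
    exact h2.trans h1

/-! ### Exchanging column bounds -/

theorem exists_mem_cell {τ : Equiv.Perm (Fin k)} {H : Gr k n} {c : Fin k → Fin n → ℂ}
    (hc : ∀ j, c j ∈ coordSubspace (C.cell τ j)) (hs : span ℂ (Set.range c) = H.1) (j : Fin k) :
    ∃ i, i ∈ C.cell τ j :=
  exists_mem_of_mem_coordSubspace (hc j) ((H.linearIndependent_of_span_eq hs).ne_zero j)

/-- Split the vector at `j'` into its entries inside the row bound of `j`, which go to `j`, and the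
remaining ones, which stay at `j'`. The hypothesis `hcov` says that the latter obey the stricter
column bound of `τ j`; it may assume the cell at `j` nonempty, since basis vectors are nonzero. -/
theorem cellSpans_subset_closure_swap {τ : Equiv.Perm (Fin k)} {j j' : Fin k} (hj : j < j')
    (hcol : C.colSet (τ j) ⊆ C.colSet (τ j'))
    (hcov : (∃ i, i ∈ C.cell τ j) → ∀ i, i ∈ C.rowSet j' → i ∈ C.colSet (τ j') →
      i ∉ C.rowSet j → i ∈ C.colSet (τ j)) :
    C.cellSpans τ ⊆ closure (C.cellSpans (τ * Equiv.swap j j')) := by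
  intro H hH
  obtain ⟨c, hc, hs⟩ := id hH
  have hcov := hcov (C.exists_mem_cell hc hs j)
  refine transversalSpans_subset_closure_of_exchange hj.ne ?_ ?_ ?_ ?_ hH
  · refine coordSubspace_mono fun i hi => ⟨hi.1, ?_⟩
    simpa using hcol hi.2
  · refine coordSubspace_mono fun i hi => ⟨C.rowSet_mono hj.le hi.1, ?_⟩
    simpa using hi.2
  · refine coordSubspace_le_sup fun i hi => ?_
    by_cases h : i ∈ C.rowSet j
    · left
      refine ⟨h, ?_⟩
      simpa using hi.2
    · right
      refine ⟨hi.1, ?_⟩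
      simpa using hcov i hi.1 hi.2 h
  · intro i h1 h2
    apply coordSubspace_mono
    rintro l ⟨hl1, hl2⟩
    refine ⟨hl1, ?_⟩
    simpa [Equiv.swap_apply_of_ne_of_ne h1 h2] using hl2

/-- A nonempty cell at `j` forces `A (τ j) ≤ row j`. An index outside the row bound of `j` is either
beyond `row j` or equal to `q ≥ s ≥ A (τ j)`, so it meets the column bound of `τ j`. -/
theorem cellSpans_subset_closure_sort {τ : Equiv.Perm (Fin k)} {j j' : Fin k} (hj : j < j')
    (h1 : ¬ C.left (τ j)) (h2 : ¬ C.left (τ j')) (h : τ j' < τ j) :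
    C.cellSpans τ ⊆ closure (C.cellSpans (τ * Equiv.swap j j')) := by
  refine C.cellSpans_subset_closure_swap hj (C.colSet_subset_of_lt h1 h2 h) ?_
  rintro ⟨i₀, hi₀, hc₀⟩ i _ _ hi
  refine ⟨fun h => absurd h h1, fun _ => ?_⟩
  by_cases hr : i ≤ C.row j
  · have hq : i = C.q := by
      by_contra hq
      exact hi ⟨hr, fun h => absurd h hq⟩
    rw [hq]
    exact (C.A_le _ h1).trans C.s_le_q
  · exact (hc₀.2 h1).trans (Fin.le_def.1 (hi₀.1.trans (not_le.1 hr).le))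

/-- Entries left at `j'` are beyond `row j ≥ s`. None of them is at `q`: if `q` is available at
`j'`, then by `h` it is available at `j`, so `q ≤ row j`. -/
theorem cellSpans_subset_closure_left {τ : Equiv.Perm (Fin k)} {j j' : Fin k} (hj : j < j')
    (h1 : C.left (τ j)) (h2 : ¬ C.left (τ j')) (h : C.HasCritical j' → C.HasCritical j) :
    C.cellSpans τ ⊆ closure (C.cellSpans (τ * Equiv.swap j j')) := by
  refine C.cellSpans_subset_closure_swap hj (C.colSet_subset_of_left h1 h2) ?_
  rintro ⟨i₀, hi₀, hc₀⟩ i hi' _ hi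
  have hr : C.row j < i := by
    by_contra hr
    exact hi ⟨not_lt.1 hr, fun hq => h (hi'.2 hq)⟩
  refine ⟨fun _ => ⟨(hc₀.1 h1).1.trans (Fin.le_def.1 (hi₀.1.trans hr.le)), fun hq => ?_⟩,
    fun h => absurd h1 h⟩
  obtain ⟨j₀, hj₀, _, hj₀'⟩ := h (hi'.2 hq)
  rw [hq] at hr
  exact absurd (hj₀'.trans (C.row_strictMono.monotone hj₀)) (not_le.2 hr)

/-- The left bound at `j` has to move to `j'`, but the vector at `j'` may have an entry at `q`,
which a left bound forbids. The vector at `j₀`, which may also have one, is used to cancel it. -/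
theorem cellSpans_subset_closure_triple {τ : Equiv.Perm (Fin k)} {j j₀ j' : Fin k} (hj : j < j₀)
    (hj' : j₀ < j') (h1 : C.left (τ j)) (h2 : ¬ C.left (τ j₀)) (h3 : ¬ C.left (τ j'))
    (h : τ j₀ < τ j') (hq₀ : C.HasCritical j₀)
    (hrow : C.q ≤ C.row j₀) :
    C.cellSpans τ ⊆
      closure (C.cellSpans (τ * Equiv.swap j j₀ * Equiv.swap j₀ j')) := by
  let τ' := τ * Equiv.swap j j₀ * Equiv.swap j₀ j'
  have t1 : τ' j = τ j₀ := by
    simp [τ', Equiv.swap_apply_of_ne_of_ne hj.ne (hj.trans hj').ne]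
  have t2 : τ' j₀ = τ j' := by
    simp [τ', Equiv.swap_apply_of_ne_of_ne (hj.trans hj').ne' hj'.ne']
  have t3 : τ' j' = τ j := by simp [τ']
  have t4 : ∀ i, i ≠ j → i ≠ j₀ → i ≠ j' → τ' i = τ i := by
    intro i a1 a2 a3
    simp [τ', Equiv.swap_apply_of_ne_of_ne a2 a3, Equiv.swap_apply_of_ne_of_ne a1 a2]
  let u : Fin k → Fin n → ℂ := fun i => if i = j₀ ∨ i = j' then Pi.single C.q 1 else 0
  have hqcell : ∀ i, i = j₀ ∨ i = j' → C.q ∈ C.cell τ i := by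
    rintro i (rfl | rfl)
    · exact ⟨⟨hrow, fun _ => hq₀⟩, fun h => absurd h h2,
        fun _ => (C.A_le _ h2).trans C.s_le_q⟩
    · exact ⟨⟨hrow.trans (C.row_strictMono.monotone hj'.le), fun _ => hq₀.mono hj'.le⟩,
        fun h => absurd h h3, fun _ => (C.A_le _ h3).trans C.s_le_q⟩
  have hu : ∀ i, u i ∈ coordSubspace (C.cell τ i) := by
    intro i
    by_cases hi : i = j₀ ∨ i = j'
    · simp only [u, if_pos hi]
      intro l hl
      rw [Pi.single_eq_of_ne]
      rintro rfl
      exact hl (hqcell i hi)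
    · simp only [u, if_neg hi]
      exact zero_mem _
  refine (transversalSpans_subset_closure_generic u hu fun _ => LinearMap.proj C.q).trans
    (closure_minimal ?_ isClosed_closure)
  rintro H ⟨c, hc, hs, hgen⟩
  have n0 : c j₀ C.q ≠ 0 := hgen j₀ (by simp [u])
  have n1 : c j' C.q ≠ 0 := hgen j' (by simp [u])
  obtain ⟨i₀, hi₀, hc₀⟩ := C.exists_mem_cell hc hs j
  have hsrow : C.s ≤ C.row j := (hc₀.1 h1).1.trans (Fin.le_def.1 hi₀.1)
  have hAA : C.A (τ j₀) ≤ C.A (τ j') := C.A_mono _ _ h2 h3 h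
  have hlow : ∀ i : Fin n, ¬ C.s ≤ i → ∀ l, j ≤ l → i ∈ C.rowSet l := by
    intro i hi l hl
    refine C.rowSet_mono hl ⟨?_, ?_⟩
    · rw [Fin.le_def]
      omega
    · rintro rfl
      exact absurd C.s_le_q hi
  -- With this ratio `c j₀ - t⁻¹ c j'` vanishes at `q`. Its entries before `s` form `x`, which fits
  -- the row bound of `j`; its entries from `s` on form `z`, which fits a left column bound; `y`
  -- completes `x` to `c j₀`.
  set t : ℂ := c j' C.q / c j₀ C.q with ht
  have ht0 : t ≠ 0 := div_ne_zero n1 n0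
  refine Gr.mem_closure_of_triple_exchange (V' := fun i => coordSubspace (C.cell τ' i)) hs
    hj.ne (hj.trans hj').ne hj'.ne ?_ ?_ ?_
    (x := fun i => if C.s ≤ i.val then 0 else c j₀ i - t⁻¹ * c j' i)
    (y := fun i => if C.s ≤ i.val then c j₀ i else t⁻¹ * c j' i)
    (z := fun i => if C.s ≤ i.val then c j₀ i - t⁻¹ * c j' i else 0)
    ?_ ?_ ?_ (μ := - t⁻¹) (neg_ne_zero.2 (inv_ne_zero ht0)) ?_ ?_ ?_
  · refine coordSubspace_mono (I := C.cell τ j) (J := C.cell τ' j) (fun i hi => ⟨hi.1, ?_⟩) (hc j)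
    rw [t1]
    exact C.colSet_subset_of_left h1 h2 hi.2
  · refine coordSubspace_mono (I := C.cell τ j) (J := C.cell τ' j₀)
      (fun i hi => ⟨C.rowSet_mono hj.le hi.1, ?_⟩) (hc j)
    rw [t2]
    exact C.colSet_subset_of_left h1 h3 hi.2
  · refine coordSubspace_mono (I := C.cell τ j) (J := C.cell τ' j')
      (fun i hi => ⟨C.rowSet_mono (hj.trans hj').le hi.1, ?_⟩) (hc j)
    rw [t3]
    exact hi.2
  · intro i hi
    by_cases hsi : C.s ≤ i.val
    · simp [hsi]
    have hA : ¬ C.A (τ j₀) ≤ i := fun hA =>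
      hi ⟨hlow i hsi j le_rfl, by rw [t1]; exact ⟨fun h => absurd h h2, fun _ => hA⟩⟩
    have e1 : c j₀ i = 0 := hc j₀ i fun hh => hA (hh.2.2 h2)
    have e2 : c j' i = 0 := hc j' i fun hh => hA (hAA.trans (hh.2.2 h3))
    simp [e1, e2]
  · intro i hi
    by_cases hsi : C.s ≤ i.val
    · have e1 : c j₀ i = 0 := hc j₀ i fun hh => hi ⟨hh.1, by
        rw [t2]; exact ⟨fun h => absurd h h3, fun _ => (C.A_le _ h3).trans hsi⟩⟩
      simp [hsi, e1]
    · have e2 : c j' i = 0 := hc j' i fun hh => hi ⟨hlow i hsi _ hj.le, by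
        rw [t2]; exact hh.2⟩
      simp [hsi, e2]
  · intro i hi
    by_cases hsi : C.s ≤ i.val
    · by_cases hiq : i = C.q
      · subst hiq
        simp only [hsi, if_true, ht]
        field_simp
        ring
      · have hr : i ∉ C.rowSet j' := fun hr => hi ⟨hr, by
          rw [t3]; exact ⟨fun _ => ⟨hsi, hiq⟩, fun h => absurd h1 h⟩⟩
        have e1 : c j₀ i = 0 := hc j₀ i fun hh => hr (C.rowSet_mono hj'.le hh.1)
        have e2 : c j' i = 0 := hc j' i fun hh => hr hh.1
        simp [e1, e2]
    · simp [hsi]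
  · ext i
    by_cases hsi : C.s ≤ i.val <;> simp [hsi]
  · ext i
    by_cases hsi : C.s ≤ i.val <;> simp [hsi] <;> ring
  · intro i a1 a2 a3
    change c i ∈ coordSubspace (C.rowSet i ∩ C.colSet (τ' i))
    rw [t4 i a1 a2 a3]
    exact hc i

end Staircase

namespace Staircase

open scoped Classical

variable {k n : ℕ} (C : Staircase k n)

/-! ### The exchanges terminate at the given column bounds -/

theorem leftCount_succ (τ : Equiv.Perm (Fin k)) (j : Fin k) :
    C.leftCount τ (j + 1) = C.leftCount τ j + if C.left (τ j) then 1 else 0 := by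
  unfold leftCount
  split_ifs with h
  · rw [← Finset.card_insert_of_notMem (a := j) (by simp)]
    congr 1
    ext i
    simp only [Finset.mem_filter, Finset.mem_univ, true_and, Finset.mem_insert]
    constructor
    · rintro ⟨h1, h2⟩
      rcases Nat.lt_succ_iff_lt_or_eq.1 h1 with h3 | h3
      · exact Or.inr ⟨h3, h2⟩
      · exact Or.inl (Fin.ext h3)
    · rintro (rfl | h1)
      · exact ⟨Nat.lt_succ_self _, h⟩
      · exact ⟨h1.1.trans (Nat.lt_succ_self _), h1.2⟩
  · rw [add_zero]
    congr 1
    ext i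
    simp only [Finset.mem_filter, Finset.mem_univ, true_and]
    refine ⟨fun ⟨h1, h2⟩ => ⟨?_, h2⟩, fun h1 => ⟨h1.1.trans (Nat.lt_succ_self _), h1.2⟩⟩
    rcases Nat.lt_succ_iff_lt_or_eq.1 h1 with h3 | h3
    · exact h3
    · rw [Fin.ext h3] at h2
      exact absurd h2 h

theorem leftCount_zero (τ : Equiv.Perm (Fin k)) : C.leftCount τ 0 = 0 := by
  simp [leftCount]

theorem leftCount_congr {τ τ' : Equiv.Perm (Fin k)} (h : ∀ i, C.left (τ' i) ↔ C.left (τ i)) (m : ℕ) :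
    C.leftCount τ' m = C.leftCount τ m := by
  unfold leftCount
  congr 1
  ext i
  simp only [Finset.mem_filter, Finset.mem_univ, true_and, h]

theorem leftCount_all (τ : Equiv.Perm (Fin k)) : C.leftCount τ k = C.leftCount 1 k := by
  unfold leftCount
  refine Finset.card_equiv τ fun i => ?_
  simp

/-- The exchange lowers only the counts at `m` with `j < m ≤ j'`, and those by one, while `hlt`
provides strict inequality exactly there. -/
theorem Dominates.swap {C : Staircase k n} {τ τ' : Equiv.Perm (Fin k)} (hd : C.Dominates τ)
    {j j' : Fin k} (hj : j < j')
    (hlt : ∀ m, j.val < m → m ≤ j' → C.leftCount 1 m < C.leftCount τ m)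
    (h1 : C.left (τ j)) (h2 : ¬ C.left (τ j'))
    (hτ' : ∀ i, C.left (τ' i) ↔ C.left (τ (Equiv.swap j j' i))) : C.Dominates τ' := by
  intro m hm
  have hτ : ∀ i, i ≠ j → i ≠ j' → (C.left (τ' i) ↔ C.left (τ i)) := by
    intro i hi hi'
    rw [hτ', Equiv.swap_apply_of_ne_of_ne hi hi']
  by_cases hm1 : m ≤ j
  · refine (hd m hm).trans (Finset.card_le_card ?_)
    intro i
    simp only [Finset.mem_filter, Finset.mem_univ, true_and]
    rintro ⟨hi, hl⟩
    refine ⟨hi, (hτ i ?_ ?_).2 hl⟩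
    · rintro rfl
      omega
    · rintro rfl
      rw [Fin.lt_def] at hj
      omega
  by_cases hm2 : m ≤ j'
  · refine Nat.le_of_lt_succ ((hlt m (by omega) hm2).trans_le ?_)
    have hsub : (Finset.univ.filter fun i : Fin k => i.val < m ∧ C.left (τ i)) ⊆
        insert j (Finset.univ.filter fun i : Fin k => i.val < m ∧ C.left (τ' i)) := by
      intro i
      simp only [Finset.mem_filter, Finset.mem_univ, true_and, Finset.mem_insert]
      rintro ⟨hi, hl⟩
      by_cases hij : i = j
      · exact Or.inl hij
      · refine Or.inr ⟨hi, (hτ i hij ?_).2 hl⟩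
        rintro rfl
        exact h2 hl
    exact (Finset.card_le_card hsub).trans (Finset.card_insert_le _ _)
  · refine (hd m hm).trans (le_of_eq ?_)
    refine Finset.card_equiv (Equiv.swap j j') fun i => ?_
    simp only [Finset.mem_filter, Finset.mem_univ, true_and, hτ', Equiv.swap_apply_self]
    refine and_congr_left fun _ => ?_
    by_cases hij : i = j
    · subst hij
      rw [Equiv.swap_apply_left]
      omega
    by_cases hij' : i = j'
    · subst hij'
      rw [Equiv.swap_apply_right]
      omega
    · rw [Equiv.swap_apply_of_ne_of_ne hij hij']

/-- The value `k` exceeds the weight of every non-left index, so moving a left bound to a later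
position raises the potential. -/
noncomputable def weight (j : Fin k) : ℕ := if C.left j then k else j

/-- The potential that increases with every exchange. -/
noncomputable def potential (τ : Equiv.Perm (Fin k)) : ℕ := ∑ j, j.val * C.weight (τ j)

theorem potential_lt_swap {τ : Equiv.Perm (Fin k)} {j j' : Fin k} (hj : j < j')
    (h : C.weight (τ j') < C.weight (τ j)) :
    C.potential τ < C.potential (τ * Equiv.swap j j') := by
  have hsplit : ∀ f : Fin k → ℕ,
      ∑ i, f i = f j + (f j' + ∑ i ∈ (Finset.univ.erase j).erase j', f i) := by
    intro f
    rw [Finset.add_sum_erase _ _ (by simp [hj.ne']), Finset.add_sum_erase _ _ (by simp)]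
  unfold potential
  rw [hsplit, hsplit fun i => i.val * C.weight ((τ * Equiv.swap j j') i)]
  have hrest : ∑ i ∈ (Finset.univ.erase j).erase j', i.val * C.weight ((τ * Equiv.swap j j') i) =
      ∑ i ∈ (Finset.univ.erase j).erase j', i.val * C.weight (τ i) := by
    refine Finset.sum_congr rfl fun i hi => ?_
    simp only [Finset.mem_erase, Finset.mem_univ, and_true] at hi
    rw [Equiv.Perm.mul_apply, Equiv.swap_apply_of_ne_of_ne hi.2 hi.1]
  rw [hrest]
  simp only [Equiv.Perm.mul_apply, Equiv.swap_apply_left, Equiv.swap_apply_right]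
  rw [Fin.lt_def] at hj
  rw [← add_assoc, ← add_assoc]
  apply Nat.add_lt_add_right
  nlinarith

theorem weight_lt_of_left {i j : Fin k} (hi : ¬ C.left i) (hj : C.left j) :
    C.weight i < C.weight j := by
  simp [weight, hi, hj]

theorem perm_eq_self_of_strictMono {p : Fin k → Prop} {τ : Equiv.Perm (Fin k)}
    (hp : ∀ i, p (τ i) ↔ p i) (hmono : ∀ i j, i < j → p i → p j → τ i < τ j) {j : Fin k} (hj : p j) :
    τ j = j := by
  let g : {i // p i} → {i // p i} := fun i => ⟨τ i, (hp i).2 i.2⟩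
  have hg : StrictMono g := fun i i' h => hmono i i' h i.2 i'.2
  have h1 := hg.le_apply (x := ⟨j, hj⟩)
  have h2 := hg.apply_le (x := ⟨j, hj⟩)
  exact congrArg Subtype.val (le_antisymm h2 h1)

/-- In a subspace variety of a staircase, the spans of transversals are dense. -/
theorem rankVariety_subset_closure :
    C.rankVariety ⊆ closure (transversalSpans fun j => coordSubspace (C.indexSet j)) := by
  intro H hH
  let P : Finset (Equiv.Perm (Fin k)) :=
    Finset.univ.filter fun τ => H ∈ closure (C.cellSpans τ) ∧ C.Dominates τ
  have hPmem : ∀ τ, τ ∈ P ↔ H ∈ closure (C.cellSpans τ) ∧ C.Dominates τ := by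
    intro τ
    simp [P]
  obtain ⟨τ₀, h0, h0'⟩ := C.exists_mem_cellSpans hH
  -- At a permutation of maximal potential no exchange is possible any more.
  obtain ⟨τ, hτ, hmax⟩ := P.exists_max_image C.potential
    ⟨τ₀, (hPmem _).2 ⟨subset_closure h0, h0'⟩⟩
  obtain ⟨hcl, hdom⟩ := (hPmem τ).1 hτ
  have hmaximal : ∀ τ', C.cellSpans τ ⊆ closure (C.cellSpans τ') → C.Dominates τ' →
      C.potential τ' ≤ C.potential τ := by
    intro τ' h1 h2
    exact hmax τ' ((hPmem τ').2 ⟨closure_minimal h1 isClosed_closure hcl, h2⟩)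
  have hsorted : ∀ j j', j < j' → ¬ C.left (τ j) → ¬ C.left (τ j') → τ j < τ j' := by
    intro j j' hj h1 h2
    by_contra hlt
    have hlt' : τ j' < τ j := lt_of_le_of_ne (not_lt.1 hlt) fun h => hj.ne' (τ.injective h)
    refine absurd (hmaximal _ (C.cellSpans_subset_closure_sort hj h1 h2 hlt') ?_)
      (not_le.2 (C.potential_lt_swap hj ?_))
    · intro m hm
      refine (hdom m hm).trans_eq (C.leftCount_congr (fun i => ?_) m).symm
      by_cases hij : i = j
      · subst hij
        simp [h1, h2]
      by_cases hij' : i = j'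
      · subst hij'
        simp [h1, h2]
      · simp [Equiv.swap_apply_of_ne_of_ne hij hij']
    · simpa [weight, h1, h2] using hlt'
  -- Otherwise let `j + 1` be the first place where the count of `τ` is ahead, and `j' + 1` the next
  -- place where the counts agree. Then `τ j` and `j'` are left, `τ j'` is not, and the strict
  -- inequality in between permits moving a left bound from `j` to `j'`.
  have hcount : ∀ m ≤ k, C.leftCount τ m = C.leftCount 1 m := by
    by_contra! hne
    let m₀ := Nat.find hne
    obtain ⟨hm₀, hm₀'⟩ := Nat.find_spec hne
    have hmin : ∀ m < m₀, C.leftCount τ m = C.leftCount 1 m := by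
      intro m hm
      have := Nat.find_min hne hm
      push Not at this
      exact this (hm.le.trans hm₀)
    obtain ⟨l, hl⟩ : ∃ l, m₀ = l + 1 := by
      refine Nat.exists_eq_succ_of_ne_zero fun h => hm₀' ?_
      change C.leftCount τ m₀ = C.leftCount 1 m₀
      rw [h, leftCount_zero, leftCount_zero]
    let j : Fin k := ⟨l, by change m₀ ≤ k at hm₀; omega⟩
    have hjgt : C.leftCount 1 (l + 1) < C.leftCount τ (l + 1) := by
      rw [← hl]
      exact lt_of_le_of_ne (hdom m₀ hm₀) fun h => hm₀' h.symm
    have hjl : C.left (τ j) := by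
      have e1 := C.leftCount_succ τ j
      have e2 := C.leftCount_succ 1 j
      have e3 := hmin l (by omega)
      change C.leftCount τ (l + 1) = C.leftCount τ l + _ at e1
      change C.leftCount 1 (l + 1) = C.leftCount 1 l + _ at e2
      by_contra h
      rw [if_neg h] at e1
      omega
    have hex : ∃ m, l + 1 < m ∧ m ≤ k ∧ C.leftCount τ m = C.leftCount 1 m := by
      refine ⟨k, lt_of_le_of_ne j.2 ?_, le_rfl, C.leftCount_all τ⟩
      intro h
      have hall : ∀ m, m = k → C.leftCount τ m = C.leftCount 1 m := by
        intro m hm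
        rw [hm, leftCount_all]
      exact hjgt.ne' (hall _ h)
    obtain ⟨hm1, hm1', hm1''⟩ := Nat.find_spec hex
    obtain ⟨l', hl'⟩ : ∃ l', Nat.find hex = l' + 1 :=
      Nat.exists_eq_succ_of_ne_zero (by omega)
    let j' : Fin k := ⟨l', by omega⟩
    have hjj' : j < j' := by
      rw [Fin.lt_def]
      change l < l'
      omega
    have hlt : ∀ m, l < m → m ≤ l' → C.leftCount 1 m < C.leftCount τ m := by
      intro m h1 h2
      refine lt_of_le_of_ne (hdom m (by omega)) fun h => ?_
      rcases Nat.lt_or_ge (l + 1) m with h3 | h3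
      · exact Nat.find_min hex (m := m) (by omega) ⟨h3, by omega, h.symm⟩
      · have : m = l + 1 := by omega
        rw [this] at h
        exact hjgt.ne h
    have hj'l : ¬ C.left (τ j') ∧ C.left j' := by
      have e1 := C.leftCount_succ τ j'
      have e2 := C.leftCount_succ 1 j'
      change C.leftCount τ (l' + 1) = C.leftCount τ l' + _ at e1
      change C.leftCount 1 (l' + 1) = C.leftCount 1 l' + if C.left j' then 1 else 0 at e2
      have e3 := hlt l' (by omega) le_rfl
      rw [hl'] at hm1''
      split_ifs at e1 e2 with c1 c2 c2
      · omega
      · omega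
      · exact ⟨c1, c2⟩
      · omega
    have hwt := C.weight_lt_of_left hj'l.1 hjl
    by_cases hq : C.HasCritical j' → C.HasCritical j
    · exact absurd (hmaximal _ (C.cellSpans_subset_closure_left hjj' hjl hj'l.1 hq)
        (hdom.swap hjj' hlt hjl hj'l.1 fun i => Iff.rfl))
        (not_le.2 (C.potential_lt_swap hjj' hwt))
    -- The direct exchange fails only if a non-left `j₀` strictly between `j` and `j'` makes `q`
    -- available. If `τ j₀` is left, exchange `j₀` and `j'`; otherwise use all three.
    push Not at hq
    obtain ⟨⟨j₀, hj₀, hj₀l, hj₀q⟩, hqj⟩ := hq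
    have hjj₀ : j < j₀ := by
      by_contra h
      exact hqj ⟨j₀, not_lt.1 h, hj₀l, hj₀q⟩
    have hj₀' : j₀ < j' := lt_of_le_of_ne hj₀ (by rintro rfl; exact hj₀l hj'l.2)
    have hq₀ : C.HasCritical j₀ := ⟨j₀, le_rfl, hj₀l, hj₀q⟩
    by_cases hτ₀ : C.left (τ j₀)
    · exact absurd (hmaximal _ (C.cellSpans_subset_closure_left hj₀' hτ₀ hj'l.1 fun _ => hq₀)
        (hdom.swap hj₀' (fun m h1 h2 => hlt m (lt_trans hjj₀ h1) h2) hτ₀ hj'l.1 fun i => Iff.rfl))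
        (not_le.2 (C.potential_lt_swap hj₀' (C.weight_lt_of_left hj'l.1 hτ₀)))
    · refine absurd (hmaximal _ (C.cellSpans_subset_closure_triple hjj₀ hj₀' hjl hτ₀ hj'l.1
        (hsorted _ _ hj₀' hτ₀ hj'l.1) hq₀ hj₀q)
        (hdom.swap hjj' hlt hjl hj'l.1 fun i => ?_))
        (not_le.2 ((C.potential_lt_swap hjj₀ (C.weight_lt_of_left hτ₀ hjl)).trans
          (C.potential_lt_swap hj₀' ?_)))
      · simp only [Equiv.Perm.mul_apply]
        by_cases i1 : i = j
        · subst i1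
          rw [Equiv.swap_apply_of_ne_of_ne hjj₀.ne hjj'.ne, Equiv.swap_apply_left,
            Equiv.swap_apply_left]
          simp [hτ₀, hj'l.1]
        by_cases i2 : i = j₀
        · subst i2
          rw [Equiv.swap_apply_left, Equiv.swap_apply_of_ne_of_ne hjj'.ne' hj₀'.ne',
            Equiv.swap_apply_of_ne_of_ne hjj₀.ne' hj₀'.ne]
          simp [hτ₀, hj'l.1]
        by_cases i3 : i = j'
        · subst i3
          rw [Equiv.swap_apply_right, Equiv.swap_apply_right, Equiv.swap_apply_right]
        · rw [Equiv.swap_apply_of_ne_of_ne i2 i3, Equiv.swap_apply_of_ne_of_ne i1 i2,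
            Equiv.swap_apply_of_ne_of_ne i1 i3]
      · simp only [Equiv.Perm.mul_apply, Equiv.swap_apply_right]
        rw [Equiv.swap_apply_of_ne_of_ne hjj'.ne' hj₀'.ne']
        exact hwt
  have hleft : ∀ j, C.left (τ j) ↔ C.left j := by
    intro j
    have e1 := C.leftCount_succ τ j
    have e2 := C.leftCount_succ 1 j
    rw [hcount _ j.2, hcount _ j.2.le, e2, Equiv.Perm.one_apply] at e1
    split_ifs at e1 with c1 c2 c2
    · exact ⟨fun _ => c1, fun _ => c2⟩
    · omega
    · omega
    · exact ⟨fun h => absurd h c2, fun h => absurd h c1⟩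
  -- Now `τ` preserves the left indices and fixes the others. It may still permute the left ones,
  -- but these all have the same column bound.
  refine closure_mono (transversalSpans_mono fun j => coordSubspace_mono ?_) hcl
  refine C.cell_subset_indexSet (hleft j) fun hj => ?_
  refine perm_eq_self_of_strictMono (p := fun i => ¬ C.left i) (fun i => not_congr (hleft i)) ?_ hj
  intro i i' h h1 h2
  exact hsorted i i' h (by rwa [hleft]) (by rwa [hleft])

end Staircase

/-! ## The shape of the nodes of the checkerboard game -/

namespace Board

variable {k n : ℕ}

/-- The black checkers are in the course of being sorted into column `d`; the red checkers strictly
left of column `d` are in squares of black checkers, and the other ones run from northeast to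
southwest. -/
structure IsSorting (B : Board k n) (d : ℕ) : Prop where
  sorted : ∀ i j : Fin n, i < j → j.val < d → B.black i < B.black j
  antidiagonal : ∀ j : Fin n, d < j.val → (B.black j).val + j.val + 1 = n
  row_strictMono : StrictMono B.row
  left : ∀ j, (B.col j).val < d → B.row j = B.black (B.col j)
  right : ∀ j j', d ≤ (B.col j).val → d ≤ (B.col j').val → j < j' → B.col j' < B.col j
  black_le_row : ∀ j, B.black (B.col j) ≤ B.row j

theorem isSorting_root {α β : Fin k ↪o Fin n} (h : ∀ i, n ≤ (α i).val + (β i.rev).val + 1) :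
    (Board.root α β).IsSorting 0 where
  sorted := by
    intro i j _ h
    omega
  antidiagonal := by
    intro j _
    have := j.2
    simp only [Board.root, Fin.revPerm_apply, Fin.val_rev]
    omega
  row_strictMono := β.strictMono
  left := by
    intro j h
    omega
  right := by
    intro j j' _ _ h
    exact α.strictMono (Fin.rev_lt_rev.2 h)
  black_le_row := by
    intro j
    have := h j.rev
    rw [Fin.rev_rev] at this
    simp only [Board.root, Fin.revPerm_apply, Fin.le_def, Fin.val_rev]
    omega

namespace IsSorting

variable {B : Board k n}

/-- The antidiagonal checkers to the right of column `d` occupy all the rows above `n - 1 - d`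
(counted from zero). -/
theorem le_black {d : Fin n} (h : B.IsSorting d) {c : Fin n} (hc : c ≤ d) :
    n ≤ (B.black c).val + d.val + 1 := by
  by_contra hlt
  have hb := (B.black c).2
  let j : Fin n := ⟨n - 1 - (B.black c).val, by omega⟩
  have hj := h.antidiagonal j (by change d.val < n - 1 - (B.black c).val; omega)
  change (B.black j).val + (n - 1 - (B.black c).val) + 1 = n at hj
  have hjc : j = c := B.black.injective (Fin.ext (by omega))
  have hjv : n - 1 - (B.black c).val = c.val := congrArg Fin.val hjc
  rw [Fin.le_def] at hc
  omega

/-- Either column `d₀` is still being sorted, or it is finished and `d = d₀ + 1`: it cannot be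
larger, as the checker of column `d₀ + 1` is above that of column `d₀`. In the second case a red
checker in column `d₀` must be on the black one, because all rows below that are taken by columns to
its left would contradict sortedness. -/
theorem of_isCritical {d₀ : ℕ} (h : B.IsSorting d₀) {d a : Fin n} (hc : IsCritical B.black d a) :
    B.IsSorting d := by
  obtain ⟨h1, h2, h3, h4⟩ := hc
  have hle : d₀ ≤ d.val := by
    by_contra hlt
    exact absurd (h.sorted a d h2 (by omega)) (not_lt.2 h3.le)
  rcases hle.eq_or_lt with rfl | hlt
  · exact h
  have hd : d.val = d₀ + 1 := by
    by_contra hne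
    have hdn := d.2
    let e : Fin n := ⟨d₀, by omega⟩
    let e' : Fin n := ⟨d₀ + 1, by omega⟩
    have hs := h1 e e' (Nat.lt_succ_self d₀) (by rw [Fin.lt_def]; change d₀ + 1 < d.val; omega)
    have h5 := IsSorting.le_black (d := e) h (c := e) le_rfl
    have h6 := h.antidiagonal e' (Nat.lt_succ_self d₀)
    change n ≤ _ + d₀ + 1 at h5
    change _ + (d₀ + 1) + 1 = n at h6
    rw [Fin.lt_def] at hs
    omega
  refine ⟨fun i j hij hj => h1 i j hij hj, fun j hj => h.antidiagonal j (by omega),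
    h.row_strictMono, fun j hj => ?_, fun j j' hj hj' => h.right j j' (by omega) (by omega),
    h.black_le_row⟩
  by_cases hj' : (B.col j).val < d₀
  · exact h.left j hj'
  have hcol : (B.col j).val = d₀ := by omega
  refine le_antisymm ?_ (h.black_le_row j)
  by_contra hlt
  rw [not_le] at hlt
  obtain ⟨c, hc⟩ := B.black.surjective (B.row j)
  have hcne : c ≠ B.col j := by
    rintro rfl
    exact hlt.ne hc
  rw [← hc] at hlt
  rcases lt_or_gt_of_ne hcne with h5 | h5
  · exact absurd (h1 _ _ h5 hj) (not_lt.2 hlt.le)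
  · have h6 := IsSorting.le_black (d := B.col j) (by rwa [hcol]) le_rfl
    rw [Fin.lt_def] at h5
    have h7 := h.antidiagonal c (by omega)
    rw [Fin.lt_def] at hlt
    omega

/-- The checker of row `σ d + 1` is left of column `d`, since columns right of `d` only reach rows
above `σ d`. Among the sorted columns it cannot precede or follow `a`. -/
theorem black_ascending {d a : Fin n} (h : B.IsSorting d) (hc : IsCritical B.black d a) :
    (B.black a).val = (B.black d).val + 1 := by
  obtain ⟨h1, h2, h3, h4⟩ := hc
  have ha := (B.black a).2
  rw [Fin.lt_def] at h3
  obtain ⟨c, hcb⟩ := B.black.surjective ⟨(B.black d).val + 1, by omega⟩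
  have hcv : (B.black c).val = (B.black d).val + 1 := congrArg Fin.val hcb
  have hd := h.le_black (le_refl d)
  have hcd : c < d := by
    rcases lt_trichotomy c d with h5 | rfl | h5
    · exact h5
    · omega
    · have := h.antidiagonal c h5
      rw [Fin.lt_def] at h5
      omega
  rcases lt_trichotomy c a with h5 | rfl | h5
  · have := h4 c h5
    rw [Fin.lt_def] at this
    omega
  · exact hcv
  · have := h1 a c h5 hcd
    rw [Fin.lt_def] at this
    omega

theorem le_col_of_row_eq {d : Fin n} (h : B.IsSorting d) {j : Fin k} (hj : B.row j = B.black d) :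
    d ≤ B.col j := by
  by_contra hlt
  rw [not_le] at hlt
  have h1 := h.left j hlt
  rw [hj] at h1
  exact hlt.ne' (B.black.injective h1)

theorem onCriticalDiagonal_iff {d : Fin n} (h : B.IsSorting d) {j : Fin k} :
    B.OnCriticalDiagonal d j ↔ B.col j < d ∧ B.black d < B.row j := by
  refine ⟨fun hj => ⟨hj.1, hj.2.1⟩, fun hj => ⟨hj.1, hj.2, rfl, ?_⟩⟩
  rw [h.left j hj.1, Equiv.symm_apply_apply]

/-! ### The moves preserve the shape. -/

section Move

variable {B' : Board k n} {d a : Fin n}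

theorem black_move_ascending (hm : BlackMove d a B B') : B'.black a = B.black d := by
  rw [hm, Equiv.swap_apply_left]

theorem black_move_descending (hm : BlackMove d a B B') : B'.black d = B.black a := by
  rw [hm, Equiv.swap_apply_right]

theorem black_move_of_ne (hm : BlackMove d a B B') {j : Fin n} (h1 : j ≠ a) (h2 : j ≠ d) :
    B'.black j = B.black j := by
  rw [hm, Equiv.swap_apply_of_ne_of_ne h1 h2]

theorem move_sorted (hc : IsCritical B.black d a) (hm : BlackMove d a B B')
    (i j : Fin n) (hij : i < j) (hj : j < d) : B'.black i < B'.black j := by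
  obtain ⟨h1, h2, h3, h4⟩ := hc
  by_cases hi : i = a
  · subst hi
    rw [black_move_ascending hm, black_move_of_ne hm hij.ne' hj.ne]
    exact h3.trans (h1 _ _ hij hj)
  rw [black_move_of_ne hm hi (hij.trans hj).ne]
  by_cases hja : j = a
  · subst hja
    rw [black_move_ascending hm]
    exact h4 i hij
  · rw [black_move_of_ne hm hja hj.ne]
    exact h1 i j hij hj

theorem move (h : B.IsSorting d) (hc : IsCritical B.black d a) (hm : BlackMove d a B B')
    (hrow : StrictMono B'.row) (hleft : ∀ j, B'.col j < d → B'.row j = B'.black (B'.col j))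
    (hright : ∀ j j', d ≤ B'.col j → d ≤ B'.col j' → j < j' → B'.col j' < B'.col j)
    (hle : ∀ j, d ≤ B'.col j → B'.black (B'.col j) ≤ B'.row j) : B'.IsSorting d where
  sorted := fun i j hij hj => move_sorted hc hm i j hij hj
  antidiagonal := by
    intro j hj
    rw [black_move_of_ne hm]
    · exact h.antidiagonal j hj
    · rintro rfl
      exact absurd hc.2.1 (not_lt.2 (Fin.le_def.2 hj.le))
    · rintro rfl
      exact hj.ne rfl
  row_strictMono := hrow
  left := hleft
  right := hright
  black_le_row := by
    intro j
    rcases lt_or_ge (B'.col j) d with hj | hj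
    · exact (hleft j hj).ge
    · exact hle j hj

/-- Red checkers that do not move stay in the squares of black checkers, unless they are in the
square of the ascending checker. -/
theorem row_eq_of_col_ne (h : B.IsSorting d) (hm : BlackMove d a B B') {j : Fin k}
    (hj : B.col j < d) (hja : B.col j ≠ a) : B.row j = B'.black (B.col j) := by
  rw [black_move_of_ne hm hja hj.ne]
  exact h.left j hj

/-- The move keeps a black checker weakly above a red checker that does not move, unless the latter
is in the square of the descending checker. -/
theorem black_move_le_row (h : B.IsSorting d) (hc : IsCritical B.black d a)
    (hm : BlackMove d a B B') {j : Fin k} (hj : d ≤ B.col j)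
    (hne : B.row j = B.black d → B.col j ≠ d) : B'.black (B.col j) ≤ B.row j := by
  have hle := h.black_le_row j
  by_cases hjd : B.col j = d
  · rw [hjd, black_move_descending hm, Fin.le_def, h.black_ascending hc]
    rw [hjd] at hle
    exact Fin.lt_def.1 (lt_of_le_of_ne hle fun h' => hne h'.symm hjd)
  · rwa [black_move_of_ne hm (hc.2.1.trans_le hj).ne' hjd]

theorem caseI (h : B.IsSorting d) (hc : IsCritical B.black d a) (hI : CaseI d a B B') :
    B'.IsSorting d := by
  obtain ⟨hm, hrow, ⟨j₀, hsq, hr', hc'⟩ | ⟨hsq, hr', hc'⟩⟩ := hI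
  · have hj₀ : B.row j₀ = B.black a := hsq.1
    have hcol₀ : B.col j₀ = a := by rw [hsq.2, Equiv.symm_apply_apply]
    have hasc := h.black_ascending hc
    have hr₀ : B'.row j₀ = B.black d := by rw [hr', Function.update_self]
    have hrne : ∀ j, j ≠ j₀ → B'.row j = B.row j := by
      intro j hj
      rw [hr', Function.update_of_ne hj]
    refine h.move hc hm ?_ ?_ ?_ ?_
    · intro i j hij
      have hlt := Fin.lt_def.1 (h.row_strictMono hij)
      rw [Fin.lt_def]
      by_cases hi : i = j₀
      · subst hi
        rw [hr₀, hrne j hij.ne']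
        rw [hj₀] at hlt
        omega
      rw [hrne i hi]
      by_cases hj : j = j₀
      · subst hj
        rw [hr₀]
        have hne : (B.row i).val ≠ (B.black d).val := fun h' => hrow i (Fin.ext h')
        rw [hj₀] at hlt
        omega
      · rwa [hrne j hj]
    · intro j hj
      rw [hc'] at hj ⊢
      by_cases hjj : j = j₀
      · subst hjj
        rw [hr₀, hcol₀, black_move_ascending hm]
      · rw [hrne j hjj]
        refine h.row_eq_of_col_ne hm hj fun hja => hjj (h.row_strictMono.injective ?_)
        rw [h.left j hj, hja, hj₀]
    · rw [hc']
      exact h.right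
    · intro j hj
      rw [hc'] at hj ⊢
      rw [hrne j]
      · exact h.black_move_le_row hc hm hj fun h' => absurd h' (hrow j)
      · rintro rfl
        rw [hcol₀] at hj
        exact absurd hc.2.1 (not_lt.2 hj)
  · refine h.move hc hm (hr' ▸ h.row_strictMono) ?_ (hc' ▸ h.right) ?_
    · intro j hj
      rw [hc'] at hj ⊢
      rw [hr']
      refine h.row_eq_of_col_ne hm hj fun hja => hsq j ⟨?_, ?_⟩
      · rw [h.left j hj, hja]
      · rw [hja, Equiv.symm_apply_apply]
    · intro j hj
      rw [hc'] at hj ⊢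
      rw [hr']
      exact h.black_move_le_row hc hm hj fun h' => absurd h' (hrow j)

/-- A red checker in the square of the ascending checker is the top one in the critical
diagonal. -/
theorem col_ne_ascending_of_top (h : B.IsSorting d) (hc : IsCritical B.black d a) {j₀ j : Fin k}
    (hj₀ : B.IsTopOnCriticalDiagonal d j₀) (hj : B.col j < d) (hne : B.col j = a → j ≠ j₀) :
    B.col j ≠ a := by
  intro hja
  have hrow := h.left j hj
  rw [hja] at hrow
  have hcrit : B.OnCriticalDiagonal d j := by
    rw [h.onCriticalDiagonal_iff, hrow]
    exact ⟨hj, hc.2.2.1⟩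
  have h1 := Fin.le_def.1 (hj₀.2 j hcrit)
  have h2 := Fin.lt_def.1 hj₀.1.2.1
  have hasc := h.black_ascending hc
  rw [hrow] at h1
  refine hne hja (h.row_strictMono.injective (Fin.ext ?_))
  rw [hrow]
  omega

/-- In Case II, no red checker is in the square of the ascending checker. -/
theorem col_ne_ascending_of_caseII (h : B.IsSorting d) (hc : IsCritical B.black d a)
    (hII : CaseII d a B B') (j : Fin k) : B.col j ≠ a := by
  intro hja
  have hj : B.col j < d := hja ▸ hc.2.1
  have hrow := h.left j hj
  have hcrit : B.OnCriticalDiagonal d j := by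
    rw [h.onCriticalDiagonal_iff, hrow, hja]
    exact ⟨hc.2.1, hc.2.2.1⟩
  obtain ⟨_, s, _, ⟨h1, _⟩ | ⟨h1, _⟩ | ⟨⟨j₀, h1, h2⟩, _⟩⟩ := hII
  · exact h1 j hcrit
  · exact h1 j hcrit
  · refine h.col_ne_ascending_of_top hc h1 hj (fun _ => ?_) hja
    rintro rfl
    exact h2 hja

theorem caseII (h : B.IsSorting d) (hc : IsCritical B.black d a) (hII : CaseII d a B B') :
    B'.IsSorting d := by
  have hcol := h.col_ne_ascending_of_caseII hc hII
  obtain ⟨hm, s, hs, hcases⟩ := hII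
  have hstay : B.col s ≠ d → B'.row = B.row → B'.col = B.col → B'.IsSorting d := by
    intro hsd hr' hc'
    refine h.move hc hm (hr' ▸ h.row_strictMono) ?_ (hc' ▸ h.right) ?_
    · intro j hj
      rw [hc'] at hj ⊢
      rw [hr']
      exact h.row_eq_of_col_ne hm hj (hcol j)
    · intro j hj
      rw [hc'] at hj ⊢
      rw [hr']
      refine h.black_move_le_row hc hm hj fun h' => ?_
      rwa [h.row_strictMono.injective (h'.trans hs.symm)]
  rcases hcases with ⟨_, hsd, hr', hc'⟩ | ⟨_, hsd, hr', hc'⟩ | ⟨_, hsd, hr', hc'⟩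
  · have hcs : B'.col s = a := by rw [hc', Function.update_self]
    have hcne : ∀ j, j ≠ s → B'.col j = B.col j := by
      intro j hj
      rw [hc', Function.update_of_ne hj]
    have hne : ∀ j, d ≤ B'.col j → j ≠ s := by
      rintro j hj rfl
      rw [hcs] at hj
      exact absurd hc.2.1 (not_lt.2 hj)
    refine h.move hc hm (hr' ▸ h.row_strictMono) ?_ ?_ ?_
    · intro j hj
      rw [hr']
      by_cases hjs : j = s
      · subst hjs
        rw [hcs, hs, black_move_ascending hm]
      · rw [hcne j hjs] at hj ⊢
        exact h.row_eq_of_col_ne hm hj (hcol j)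
    · intro i j hi hj hij
      have hi' := hne i hi
      have hj' := hne j hj
      rw [hcne _ hi'] at hi ⊢
      rw [hcne _ hj'] at hj ⊢
      exact h.right i j hi hj hij
    · intro j hj
      have hj' := hne j hj
      rw [hcne _ hj'] at hj ⊢
      rw [hr']
      exact h.black_move_le_row hc hm hj fun h' =>
        absurd (h.row_strictMono.injective (h'.trans hs.symm)) hj'
  · exact hstay hsd hr' hc'
  · exact hstay hsd hr' hc'

theorem caseIII (h : B.IsSorting d) (hc : IsCritical B.black d a) (hIII : CaseIII d a B B') :
    B'.IsSorting d := by
  obtain ⟨hm, s, t, hs, ht, hblock, hr', hc'⟩ := hIII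
  have hsd : d ≤ B.col s := h.le_col_of_row_eq hs
  have htd : B.col t < d := ht.1.1
  have htrow : B.black d < B.row t := ht.1.2.1
  have hasc := h.black_ascending hc
  have hst : s < t := by
    rw [← h.row_strictMono.lt_iff_lt, hs]
    exact htrow
  have hcs : B'.col s = a := by rw [hc', Function.update_self]
  have hct : B'.col t = B.col s := by
    rw [hc', Function.update_of_ne hst.ne', Function.update_self]
  have hcne : ∀ j, j ≠ s → j ≠ t → B'.col j = B.col j := by
    intro j hjs hjt
    rw [hc', Function.update_of_ne hjs, Function.update_of_ne hjt]
  have hne : ∀ j, d ≤ B'.col j → j ≠ s := by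
    rintro j hj rfl
    rw [hcs] at hj
    exact absurd hc.2.1 (not_lt.2 hj)
  refine h.move hc hm (hr' ▸ h.row_strictMono) ?_ ?_ ?_
  · intro j hj
    rw [hr']
    by_cases hjs : j = s
    · subst hjs
      rw [hcs, hs, black_move_ascending hm]
    by_cases hjt : j = t
    · subst hjt
      rw [hct] at hj
      exact absurd hj (not_lt.2 hsd)
    · rw [hcne j hjs hjt] at hj ⊢
      exact h.row_eq_of_col_ne hm hj (h.col_ne_ascending_of_top hc ht hj fun _ => hjt)
  · intro i j hi hj hij
    have hi' := hne i hi
    have hj' := hne j hj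
    by_cases hit : i = t
    · subst hit
      rw [hcne j hj' hij.ne'] at hj ⊢
      rw [hct]
      exact h.right s j hsd hj (hst.trans hij)
    rw [hcne i hi' hit] at hi ⊢
    by_cases hjt : j = t
    · subst hjt
      rw [hct]
      rcases lt_or_gt_of_ne hi' with his | his
      · exact h.right i s hi hsd his
      -- A checker `i` between `s` and `t` would be a blocker. In the two unblocked cases there is
      -- no room for it: left of `col s = d`, or strictly between the rows `r` and `r + 1`.
      · exfalso
        have hcol := h.right s i hsd hi his
        have hrs := h.row_strictMono his
        have hrt := h.row_strictMono hij
        rcases hblock with hb | hb | hb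
        · rw [hb] at hcol
          exact absurd hcol (not_lt.2 hi)
        · have htr := h.left j htd
          rw [hb] at htr
          rw [hs, Fin.lt_def] at hrs
          rw [htr, Fin.lt_def] at hrt
          omega
        · exact hb ⟨i, hrs, hrt, htd.trans_le hi, hcol⟩
    · rw [hcne j hj' hjt] at hj ⊢
      exact h.right i j hi hj hij
  · intro j hj
    have hj' := hne j hj
    rw [hr']
    by_cases hjt : j = t
    · subst hjt
      rw [hct]
      have hle := h.black_le_row s
      by_cases hsd' : B.col s = d
      · rw [hsd', black_move_descending hm, Fin.le_def, hasc]
        exact htrow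
      · rw [black_move_of_ne hm (hc.2.1.trans_le hsd).ne' hsd']
        exact hle.trans (hs ▸ htrow.le)
    · rw [hcne j hj' hjt] at hj ⊢
      exact h.black_move_le_row hc hm hj fun h' =>
        absurd (h.row_strictMono.injective (h'.trans hs.symm)) hj'

end Move

end IsSorting

theorem IsNode.exists_isSorting {α β : Fin k ↪o Fin n} {B : Board k n} (h : IsNode α β B) :
    ∃ d, B.IsSorting d := by
  induction h with
  | root h => exact ⟨0, isSorting_root h⟩
  | @child B B' d a _ hc hm ih =>
    obtain ⟨d₀, hd₀⟩ := ih
    have hd := hd₀.of_isCritical hc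
    rcases hm with hm | hm | hm
    · exact ⟨d, hd.caseI hc hm⟩
    · exact ⟨d, hd.caseII hc hm⟩
    · exact ⟨d, hd.caseIII hc hm⟩

end Board

/-! ## Density of the transversal spans in checkerboard varieties -/

section Varieties

open Submodule (span subset_span span_le mem_sup smul_mem)

variable {k n : ℕ}

/-- The linear automorphism given by an invertible matrix. -/
noncomputable def mulVecEquiv (M : Matrix (Fin n) (Fin n) ℂ) (hM : IsUnit M.det) :
    (Fin n → ℂ) ≃ₗ[ℂ] (Fin n → ℂ) :=
  LinearEquiv.ofBijective M.mulVecLin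
    ⟨Matrix.mulVec_injective_iff_isUnit.2 ((Matrix.isUnit_iff_isUnit_det M).2 hM),
      Matrix.mulVec_surjective_iff_isUnit.2 ((Matrix.isUnit_iff_isUnit_det M).2 hM)⟩

theorem map_mulVecLin_coordSubspace (M : Matrix (Fin n) (Fin n) ℂ) (I : Set (Fin n)) :
    (coordSubspace I).map M.mulVecLin = span ℂ {v | ∃ i ∈ I, v = M.col i} := by
  rw [coordSubspace_eq_span, Submodule.map_span]
  congr 1
  ext v
  constructor
  · rintro ⟨_, ⟨i, hi, rfl⟩, rfl⟩
    exact ⟨i, hi, by simp⟩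
  · rintro ⟨i, hi, rfl⟩
    exact ⟨_, ⟨i, hi, rfl⟩, by simp⟩

namespace Board

theorem northwestSpan_eq_map (B : Board k n) (M : Matrix (Fin n) (Fin n) ℂ) (S : Finset (Fin k)) :
    B.northwestSpan M S = (coordSubspace {i | ∃ j ∈ S, B.NW i j}).map M.mulVecLin := by
  rw [map_mulVecLin_coordSubspace]
  rfl

theorem transversalSpans_subset_variety (B : Board k n) (M : Matrix (Fin n) (Fin n) ℂ) :
    transversalSpans (fun j => (coordSubspace {i | B.NW i j}).map M.mulVecLin) ⊆ B.variety M := by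
  intro H hH S
  refine Gr.dim_le_of_transversal hH S fun j hj => ?_
  rw [northwestSpan_eq_map]
  exact Submodule.map_mono (coordSubspace_mono fun i hi => ⟨j, hj, hi⟩)

namespace IsSorting

variable {B : Board k n} {d : Fin n}

/-- The staircase of the sets of black checkers northwest of the red checkers. -/
def staircase (h : B.IsSorting d) : Staircase k n where
  row := B.row
  left := fun j => B.col j < d
  A := fun j => n - 1 - (B.col j).val
  s := n - 1 - d.val
  q := B.black d
  row_strictMono := h.row_strictMono
  s_le_q := by
    have := h.le_black (le_refl d)
    omega
  A_le := by
    intro j hj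
    rw [not_lt, Fin.le_def] at hj
    omega
  A_mono := by
    intro j j' hj hj' hlt
    have := Fin.lt_def.1 (h.right j j' (not_lt.1 hj) (not_lt.1 hj') hlt)
    omega

/-- A red checker left of `d` is on a black checker of the sorted part, so within that part the row
bound already implies the column bound; only the checkers in and right of column `d` have to be
excluded. For the other red checkers, the column bound cuts the antidiagonal part at row `n - 1 -
col j`. -/
theorem nw_iff (h : B.IsSorting d) (i : Fin n) (j : Fin k) :
    B.NW i j ↔ i ∈ h.staircase.indexSet j := by
  obtain ⟨c, rfl⟩ := B.black.surjective i
  change B.black c ≤ B.row j ∧ B.black.symm (B.black c) ≤ B.col j ↔ B.black c ≤ B.row j ∧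
    (B.col j < d → n - 1 - d.val ≤ B.black c ∧ B.black c ≠ B.black d) ∧
    (¬ B.col j < d → n - 1 - (B.col j).val ≤ B.black c)
  rw [Equiv.symm_apply_apply]
  refine and_congr_right fun hrow => ?_
  by_cases hj : B.col j < d
  · simp only [hj, true_implies, not_true_eq_false, false_implies, and_true]
    constructor
    · intro hc
      have hcd := hc.trans_lt hj
      have := h.le_black hcd.le
      exact ⟨by omega, fun h' => hcd.ne (B.black.injective h')⟩
    · rintro ⟨h1, h2⟩
      by_contra hlt
      rw [not_le] at hlt
      rcases lt_trichotomy c d with h3 | rfl | h3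
      · have := h.sorted _ _ hlt h3
        rw [← h.left j hj] at this
        exact absurd hrow (not_le.2 this)
      · exact h2 rfl
      · have := h.antidiagonal c h3
        rw [Fin.lt_def] at h3
        omega
  · simp only [hj, false_implies, true_and, not_false_eq_true, true_implies]
    rw [not_lt, Fin.le_def] at hj
    rcases le_or_gt c d with h3 | h3
    · have := h.le_black h3
      rw [Fin.le_def] at h3 ⊢
      constructor <;> intro <;> omega
    · have := h.antidiagonal c h3
      have := (B.col j).2
      rw [Fin.le_def]
      constructor <;> intro <;> omega

theorem nw_row (h : B.IsSorting d) (j : Fin k) : B.NW (B.row j) j := by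
  rw [h.nw_iff]
  refine ⟨le_rfl, fun hj => ?_, fun hj => ?_⟩
  · have hj' : B.col j < d := hj
    change n - 1 - d.val ≤ (B.row j).val ∧ B.row j ≠ B.black d
    rw [h.left j hj']
    have := h.le_black hj'.le
    exact ⟨by omega, fun h' => hj'.ne (B.black.injective h')⟩
  · have hj' : d ≤ B.col j := not_lt.1 hj
    change n - 1 - (B.col j).val ≤ (B.row j).val
    have h1 := Fin.le_def.1 (h.black_le_row j)
    rcases hj'.eq_or_lt with h2 | h2
    · have := h.le_black h2.ge
      rw [h2] at this
      omega
    · have := h.antidiagonal (B.col j) h2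
      omega

/-- The automorphism given by `M` reduces this to the standard basis, where the conditions are those
of the staircase. -/
theorem variety_subset_closure (h : B.IsSorting d) {M : Matrix (Fin n) (Fin n) ℂ}
    (hM : IsUnit M.det) : B.variety M ⊆ closure (transversalSpans fun j =>
      (coordSubspace {i | B.NW i j}).map M.mulVecLin) := by
  intro H hH
  let e := mulVecEquiv M hM
  refine Gr.map_mem_closure (e := e) (V := fun j => coordSubspace {i | B.NW i j}) ?_
  have hsets : ∀ j, {i | B.NW i j} = h.staircase.indexSet j := fun j => Set.ext fun i => h.nw_iff i j
  simp only [hsets]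
  refine h.staircase.rankVariety_subset_closure fun S => (hH S).trans (le_of_eq ?_)
  rw [northwestSpan_eq_map]
  have hS : {i | ∃ j ∈ S, B.NW i j} = {i | ∃ j ∈ S, i ∈ h.staircase.indexSet j} := by
    simp only [h.nw_iff]
  rw [hS]
  generalize coordSubspace {i | ∃ j ∈ S, i ∈ h.staircase.indexSet j} = W
  have hmap : ((Gr.map e.symm H).1 ⊓ W).map (e : (Fin n → ℂ) →ₗ[ℂ] (Fin n → ℂ)) =
      H.1 ⊓ W.map M.mulVecLin := by
    rw [Submodule.map_inf _ e.injective]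
    congr 1
    exact congrArg Subtype.val (Gr.map_symm_map e H)
  rw [← hmap, LinearEquiv.finrank_map_eq]

end IsSorting

end Board

end Varieties

/-! ## Parent and child in Case II -/

namespace Board

variable {k n : ℕ}

/-- How the sets of black checkers northwest of a red checker change in Case II: apart from the two
moving rows they do not change, and the red checkers come in four classes. -/
structure NWChange (B B' : Board k n) (r r' : Fin n) (E : Fin k → Prop) : Prop where
  nw_iff : ∀ i j, i ≠ r → i ≠ r' → (B.NW i j ↔ B'.NW i j)
  classes : ∀ j,
    (¬ E j ∧ B'.row j < r ∧ ¬ B.NW r j ∧ ¬ B.NW r' j ∧ ¬ B'.NW r j ∧ ¬ B'.NW r' j) ∨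
    (¬ E j ∧ B'.row j = r ∧ B.NW r j ∧ ¬ B.NW r' j ∧ B'.NW r j ∧ ¬ B'.NW r' j) ∨
    (E j ∧ r' < B'.row j ∧ ¬ B.NW r j ∧ B.NW r' j ∧ B'.NW r j ∧ ¬ B'.NW r' j) ∨
    (¬ E j ∧ B.NW r j ∧ B.NW r' j ∧ B'.NW r j ∧ B'.NW r' j)

namespace IsSorting

variable {B B' : Board k n} {d a : Fin n}

theorem black_symm_move (hm : BlackMove d a B B') (i : Fin n) :
    B'.black.symm i = Equiv.swap a d (B.black.symm i) := by
  rw [Equiv.symm_apply_eq, hm, Equiv.swap_apply_self, Equiv.apply_symm_apply]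

theorem row_of_caseII (hII : CaseII d a B B') : B'.row = B.row := by
  obtain ⟨_, _, _, ⟨_, _, h, _⟩ | ⟨_, _, h, _⟩ | ⟨_, _, h, _⟩⟩ := hII <;> exact h

/-- Either no red checker moves and none of them is in the new square of the ascending checker, or
the red checker of the critical row moves there, and there are no red checkers in the critical
diagonal. -/
theorem col_of_caseII (h : B.IsSorting d) (hII : CaseII d a B B') :
    (B'.col = B.col) ∨
    ∃ s, B.row s = B.black d ∧ B.col s = d ∧ B'.col = Function.update B.col s a ∧
      ∀ j, B.col j < d → ¬ B.black d < B.row j := by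
  obtain ⟨_, s, hs, ⟨h1, h2, _, h4⟩ | ⟨_, _, _, h4⟩ | ⟨_, _, _, h4⟩⟩ := hII
  · exact Or.inr ⟨s, hs, h2, h4, fun j hj hj' => h1 j (h.onCriticalDiagonal_iff.2 ⟨hj, hj'⟩)⟩
  · exact Or.inl h4
  · exact Or.inl h4

/-- The four classes are the red checkers above row `r`, in row `r`, below it and left of column `d`
(region `E`), and below it and not left of `d`. -/
theorem nwChange_of_caseII (h : B.IsSorting d) (hc : IsCritical B.black d a)
    (hII : CaseII d a B B') :
    NWChange B B' (B.black d) (B.black a) (InRegionE B.black d B') := by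
  have hrow := row_of_caseII hII
  have hasc := h.black_ascending hc
  have hcolne := h.col_ne_ascending_of_caseII hc hII
  have hcol := h.col_of_caseII hII
  obtain ⟨hm, -⟩ := hII
  have hlt : B.black d < B.black a := hc.2.2.1
  have hsymm : ∀ i, i ≠ B.black d → i ≠ B.black a → B'.black.symm i = B.black.symm i := by
    intro i h1 h2
    rw [black_symm_move hm, Equiv.swap_apply_of_ne_of_ne]
    · rintro rfl
      simp at h2
    · rintro rfl
      simp at h1
  have hsymmd : B'.black.symm (B.black d) = a := by
    rw [black_symm_move hm, Equiv.symm_apply_apply, Equiv.swap_apply_right]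
  have hsymma : B'.black.symm (B.black a) = d := by
    rw [black_symm_move hm, Equiv.symm_apply_apply, Equiv.swap_apply_left]
  have hnwd : ∀ j, B.NW (B.black d) j ↔ B.black d ≤ B.row j ∧ d ≤ B.col j := by
    intro j
    rw [NW, Equiv.symm_apply_apply]
  have hnwa : ∀ j, B.NW (B.black a) j ↔ B.black a ≤ B.row j ∧ a ≤ B.col j := by
    intro j
    rw [NW, Equiv.symm_apply_apply]
  have hnwd' : ∀ j, B'.NW (B.black d) j ↔ B.black d ≤ B.row j ∧ a ≤ B'.col j := by
    intro j
    rw [NW, hsymmd, hrow]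
  have hnwa' : ∀ j, B'.NW (B.black a) j ↔ B.black a ≤ B.row j ∧ d ≤ B'.col j := by
    intro j
    rw [NW, hsymma, hrow]
  -- Moving the red checker from column `d` to column `a` loses no other black checker: those in
  -- columns strictly between are below row `r + 1`.
  have hmoved : ∀ s, B.row s = B.black d → B.col s = d → B'.col s = a →
      ∀ i, i ≠ B.black d → i ≠ B.black a → (B.NW i s ↔ B'.NW i s) := by
    intro s hs hsd hsa i h1 h2
    rw [NW, NW, hsymm i h1 h2, hrow, hs, hsd, hsa]
    refine and_congr_right fun hi => ⟨fun hle => ?_, fun hle => hle.trans hc.2.1.le⟩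
    have hne : B.black.symm i ≠ d := by
      intro h'
      rw [Equiv.symm_apply_eq] at h'
      exact h1 h'
    by_contra hgt
    have := h.sorted a (B.black.symm i) (not_le.1 hgt) (Fin.lt_def.1 (lt_of_le_of_ne hle hne))
    rw [Equiv.apply_symm_apply] at this
    exact absurd (hlt.trans this) (not_lt.2 hi)
  have hcolj : ∀ j, B'.col j = B.col j ∨ (B.row j = B.black d ∧ B.col j = d ∧ B'.col j = a) := by
    intro j
    rcases hcol with h' | ⟨s, hs, hsd, h', _⟩
    · exact Or.inl (congrFun h' j)
    · by_cases hj : j = s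
      · subst hj
        exact Or.inr ⟨hs, hsd, by rw [h', Function.update_self]⟩
      · exact Or.inl (by rw [h', Function.update_of_ne hj])
  refine ⟨fun i j h1 h2 => ?_, fun j => ?_⟩
  · rcases hcolj j with h' | ⟨hs, hsd, h'⟩
    · rw [NW, NW, hsymm i h1 h2, hrow, h']
    · exact hmoved j hs hsd h' i h1 h2
  · simp only [InRegionE, hrow, hnwd, hnwa, hnwd', hnwa']
    have hda : ¬ B.black a ≤ B.black d := not_le.2 hlt
    rcases hcolj j with h' | ⟨hs, hsd, h'⟩
    · rw [h']
      rcases lt_trichotomy (B.row j) (B.black d) with h1 | h1 | h1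
      · have h2 := not_le.2 h1
        have h3 := not_le.2 (h1.trans hlt)
        exact Or.inl ⟨fun hh => h1.asymm hh.1, h1, fun hh => h2 hh.1, fun hh => h3 hh.1,
          fun hh => h2 hh.1, fun hh => h3 hh.1⟩
      · have h2 := h.le_col_of_row_eq h1
        rw [h1]
        exact Or.inr (Or.inl ⟨fun hh => lt_irrefl _ hh.1, rfl, ⟨le_rfl, h2⟩, fun hh => hda hh.1,
          ⟨le_rfl, hc.2.1.le.trans h2⟩, fun hh => hda hh.1⟩)
      · have h2 : B.black a ≤ B.row j := by
          rw [Fin.le_def, hasc]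
          exact h1
        rcases lt_or_ge (B.col j) d with h3 | h3
        · have h4 := h.left j h3
          have h5 : B.row j ≠ B.black a := by
            rw [h4]
            exact fun hh => hcolne j (B.black.injective hh)
          have h6 : a ≤ B.col j := by
            by_contra hh
            have := hc.2.2.2 _ (not_le.1 hh)
            rw [← h4] at this
            exact this.asymm h1
          have h7 := not_le.2 h3
          exact Or.inr (Or.inr (Or.inl ⟨⟨h1, h3, h4 ▸ h1⟩, lt_of_le_of_ne h2 h5.symm,
            fun hh => h7 hh.2, ⟨h2, h6⟩, ⟨h1.le, h6⟩, fun hh => h7 hh.2⟩))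
        · have h4 := hc.2.1.le.trans h3
          exact Or.inr (Or.inr (Or.inr ⟨fun hh => absurd hh.2.1 (not_lt.2 h3), ⟨h1.le, h3⟩,
            ⟨h2, h4⟩, ⟨h1.le, h4⟩, h2, h3⟩))
    · rw [hs, hsd, h']
      exact Or.inr (Or.inl ⟨fun hh => lt_irrefl _ hh.1, rfl, ⟨le_rfl, le_rfl⟩, fun hh => hda hh.1,
        ⟨le_rfl, le_rfl⟩, fun hh => hda hh.1⟩)

/-- If there are red checkers in region `E`, then the red checker of the critical row is not in the
new square of the ascending checker. -/
theorem col_ne_of_inRegionE (h : B.IsSorting d) (hc : IsCritical B.black d a)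
    (hII : CaseII d a B B') {j j' : Fin k} (hE : InRegionE B.black d B' j)
    (hj' : B'.row j' = B.black d) : B'.col j' ≠ a := by
  rw [row_of_caseII hII] at hj'
  obtain ⟨hE1, hE2, -⟩ := hE
  rw [row_of_caseII hII] at hE1
  rcases h.col_of_caseII hII with h' | ⟨s, hs, hsd, h', hcrit⟩
  · rw [h']
    exact (hc.2.1.trans_le (h.le_col_of_row_eq hj')).ne'
  · have hjs : j ≠ s := by
      rintro rfl
      exact hE1.ne' hs
    rw [h', Function.update_of_ne hjs] at hE2
    exact absurd hE1 (hcrit j hE2)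

end IsSorting

end Board

/-! ## The moving coordinates -/

section Coordinates

open Submodule (span subset_span span_le mem_sup smul_mem)

variable {k n : ℕ}

/-- The automorphism subtracting `t` times the `r`-th entry from the `r'`-th one. -/
def shear {r r' : Fin n} (hr : r ≠ r') (t : ℂ) : (Fin n → ℂ) ≃ₗ[ℂ] (Fin n → ℂ) where
  toFun y := fun i => if i = r' then y i - t * y r else y i
  invFun y := fun i => if i = r' then y i + t * y r else y i
  map_add' := by
    intro y z
    ext i
    by_cases hi : i = r' <;> simp [hi]
    ring
  map_smul' := by
    intro c y
    ext i
    by_cases hi : i = r' <;> simp [hi]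
    ring
  left_inv := by
    intro y
    ext i
    by_cases hi : i = r' <;> simp [hi, hr]
  right_inv := by
    intro y
    ext i
    by_cases hi : i = r' <;> simp [hi, hr]

theorem shear_apply {r r' : Fin n} (hr : r ≠ r') (t : ℂ) (y : Fin n → ℂ) (i : Fin n) :
    shear hr t y i = if i = r' then y i - t * y r else y i := rfl

theorem shear_symm_apply {r r' : Fin n} (hr : r ≠ r') (t : ℂ) (y : Fin n → ℂ) (i : Fin n) :
    (shear hr t).symm y i = if i = r' then y i + t * y r else y i := rfl

/-- The coordinates of a vector that has the coordinates `u` in the moving basis. -/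
def movingCoords (r r' : Fin n) (t : ℂ) (u : Fin n → ℂ) : Fin n → ℂ :=
  fun i => if i = r then u r + u r' else if i = r' then -t * u r else u i

theorem movingBasis_mulVec (M : Matrix (Fin n) (Fin n) ℂ) {r r' : Fin n} (hr : r ≠ r') (t : ℂ)
    (u : Fin n → ℂ) :
    (movingBasis M r r' t).mulVec u = M.mulVec (movingCoords r r' t u) := by
  have hsplit : ∀ f : Fin n → ℂ,
      ∑ i, f i = f r + (f r' + ∑ i ∈ (Finset.univ.erase r).erase r', f i) := by
    intro f
    rw [Finset.add_sum_erase _ _ (by simp [hr.symm]), Finset.add_sum_erase _ _ (by simp)]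
  ext l
  simp only [Matrix.mulVec, dotProduct]
  rw [hsplit, hsplit fun i => M l i * movingCoords r r' t u i]
  have hrest : ∑ i ∈ (Finset.univ.erase r).erase r', movingBasis M r r' t l i * u i =
      ∑ i ∈ (Finset.univ.erase r).erase r', M l i * movingCoords r r' t u i := by
    refine Finset.sum_congr rfl fun i hi => ?_
    simp only [Finset.mem_erase, Finset.mem_univ, and_true] at hi
    simp [movingBasis, movingCoords, hi.1, hi.2]
  rw [hrest]
  simp only [movingBasis, movingCoords, Matrix.of_apply, hr.symm, if_true, if_false]
  ring

theorem isUnit_det_movingBasis {M : Matrix (Fin n) (Fin n) ℂ} (hM : IsUnit M.det) {r r' : Fin n}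
    (hr : r ≠ r') {t : ℂ} (ht : t ≠ 0) : IsUnit (movingBasis M r r' t).det := by
  rw [← Matrix.isUnit_iff_isUnit_det, ← Matrix.mulVec_injective_iff_isUnit] at hM ⊢
  intro u v huv
  rw [movingBasis_mulVec M hr, movingBasis_mulVec M hr] at huv
  have h := hM huv
  have h1 : u r = v r := by
    have := congrFun h r'
    simpa [movingCoords, hr.symm, ht] using this
  ext i
  by_cases hi : i = r
  · rw [hi, h1]
  by_cases hi' : i = r'
  · have := congrFun h r
    simpa [movingCoords, h1, hi'] using this
  · have := congrFun h i
    simpa [movingCoords, hi, hi'] using this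

namespace Board

open scoped Classical

/-- The coordinate change of the `j`-th column in the family `familyII`. -/
noncomputable def columnShear {r r' : Fin n} (hr : r ≠ r') (E : Fin k → Prop) (t : ℂ)
    (j : Fin k) : (Fin n → ℂ) ≃ₗ[ℂ] (Fin n → ℂ) :=
  if E j then LinearEquiv.refl ℂ _ else shear hr t

theorem columnShear_of {r r' : Fin n} (hr : r ≠ r') {E : Fin k → Prop} (t : ℂ) {j : Fin k}
    (h : E j) : columnShear hr E t j = LinearEquiv.refl ℂ _ := if_pos h

theorem columnShear_of_not {r r' : Fin n} (hr : r ≠ r') {E : Fin k → Prop} (t : ℂ) {j : Fin k}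
    (h : ¬ E j) : columnShear hr E t j = shear hr t := if_neg h

theorem columnShear_zero {r r' : Fin n} (hr : r ≠ r') (E : Fin k → Prop) (j : Fin k) :
    columnShear hr E 0 j = LinearEquiv.refl ℂ _ := by
  unfold columnShear
  split_ifs
  · rfl
  · ext y i
    simp [shear_apply]

variable {B B' : Board k n} {r r' : Fin n} {E : Fin k → Prop}

/-- The subspaces of the parent in the moving basis are those of the child in the coordinates of
the family. -/
theorem NWChange.map_movingBasis (hB : NWChange B B' r r' E) (hr : r ≠ r')
    (M : Matrix (Fin n) (Fin n) ℂ) {t : ℂ} (ht : t ≠ 0) (j : Fin k) :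
    (coordSubspace {i | B.NW i j}).map (movingBasis M r r' t).mulVecLin =
      ((coordSubspace {i | B'.NW i j}).map
        (columnShear hr E t j : (Fin n → ℂ) →ₗ[ℂ] (Fin n → ℂ))).map M.mulVecLin := by
  have hother : ∀ i, i ≠ r → i ≠ r' → (¬ B.NW i j ↔ ¬ B'.NW i j) := fun i h1 h2 =>
    not_congr (hB.nw_iff i j h1 h2)
  ext w
  constructor
  · rintro ⟨u, hu, rfl⟩
    refine ⟨movingCoords r r' t u, ?_, (movingBasis_mulVec M hr t u).symm⟩
    rw [SetLike.mem_coe, Submodule.mem_map_equiv]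
    intro i hi
    have hi : ¬ B'.NW i j := hi
    rcases hB.classes j with ⟨hE, -, c1, c2, c3, c4⟩ | ⟨hE, -, c1, c2, c3, c4⟩ |
      ⟨hE, -, c1, c2, c3, c4⟩ | ⟨hE, c1, c2, c3, c4⟩
    all_goals
      first
      | rw [columnShear_of hr t hE]
        simp only [LinearEquiv.refl_symm, LinearEquiv.refl_apply]
      | rw [columnShear_of_not hr t hE, shear_symm_apply]
      by_cases h1 : i = r
      · subst h1
        first
        | exact absurd c3 hi
        | simp [movingCoords, hr, hu _ c1, hu _ c2]
      by_cases h2 : i = r'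
      · subst h2
        first
        | exact absurd c4 hi
        | simp [movingCoords, h1, hu _ c2]
        | simp [movingCoords, h1, hu _ c1]
      · have := hu i ((hother i h1 h2).2 hi)
        simp [movingCoords, h1, h2, this]
  · rintro ⟨v, hv, rfl⟩
    rw [SetLike.mem_coe, Submodule.mem_map_equiv] at hv
    let u : Fin n → ℂ := fun i =>
      if i = r then - (v r' / t) else if i = r' then v r + v r' / t else v i
    have huv : movingCoords r r' t u = v := by
      ext i
      by_cases h1 : i = r
      · subst h1
        simp [movingCoords, u, hr.symm]
      by_cases h2 : i = r'
      · subst h2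
        simp [movingCoords, u, h1]
        field_simp
      · simp [movingCoords, u, h1, h2]
    refine ⟨u, ?_, ?_⟩
    · intro i hi
      have hi : ¬ B.NW i j := hi
      rcases hB.classes j with ⟨hE, -, c1, c2, c3, c4⟩ | ⟨hE, -, c1, c2, c3, c4⟩ |
        ⟨hE, -, c1, c2, c3, c4⟩ | ⟨hE, c1, c2, c3, c4⟩
      · rw [columnShear_of_not hr t hE] at hv
        have e1 := hv r c3
        have e2 := hv r' c4
        rw [shear_symm_apply, if_neg hr] at e1
        rw [shear_symm_apply, if_pos rfl, e1, mul_zero, add_zero] at e2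
        by_cases h1 : i = r
        · simp [u, h1, e2]
        by_cases h2 : i = r'
        · simp [u, h2, hr.symm, e1, e2]
        · have := hv i ((hother i h1 h2).1 hi)
          rw [shear_symm_apply, if_neg h2] at this
          simp [u, h1, h2, this]
      · rw [columnShear_of_not hr t hE] at hv
        have e2 := hv r' c4
        rw [shear_symm_apply, if_pos rfl] at e2
        by_cases h1 : i = r
        · exact absurd c1 (h1 ▸ hi)
        by_cases h2 : i = r'
        · simp only [u, h2, hr.symm, if_true, if_false]
          rw [show v r' = -(t * v r) by linear_combination e2]
          field_simp
          ring
        · have := hv i ((hother i h1 h2).1 hi)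
          rw [shear_symm_apply, if_neg h2] at this
          simp [u, h1, h2, this]
      · rw [columnShear_of hr t hE] at hv
        have e2 : v r' = 0 := hv r' c4
        by_cases h1 : i = r
        · simp [u, h1, e2]
        by_cases h2 : i = r'
        · exact absurd c2 (h2 ▸ hi)
        · have : v i = 0 := hv i ((hother i h1 h2).1 hi)
          simp [u, h1, h2, this]
      · rw [columnShear_of_not hr t hE] at hv
        by_cases h1 : i = r
        · exact absurd c1 (h1 ▸ hi)
        by_cases h2 : i = r'
        · exact absurd c2 (h2 ▸ hi)
        · have := hv i ((hother i h1 h2).1 hi)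
          rw [shear_symm_apply, if_neg h2] at this
          simp [u, h1, h2, this]
    · rw [Matrix.mulVecLin_apply, Matrix.mulVecLin_apply, movingBasis_mulVec M hr, huv]

end Board

end Coordinates

/-! ### Echelon forms. -/

section Echelon

open Submodule (span subset_span span_le mem_sup smul_mem)

variable {k n : ℕ}

/-- The rows `ρ` single out a triangular square submatrix with nonzero diagonal. -/
theorem linearIndependent_of_echelon {ρ : Fin k → Fin n} (hρ : StrictMono ρ)
    {w : Fin k → Fin n → ℂ} (hw : ∀ j, w j (ρ j) ≠ 0) (hw0 : ∀ j i, ρ j < i → w j i = 0) :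
    LinearIndependent ℂ w := by
  let N : Matrix (Fin k) (Fin k) ℂ := Matrix.of fun j j' => w j (ρ j')
  have hdet : N.det ≠ 0 := by
    rw [Matrix.det_of_isLowerTriangular]
    · exact Finset.prod_ne_zero_iff.2 fun j _ => hw j
    · intro j j' hlt
      exact hw0 j _ (hρ hlt)
  have hN := Matrix.linearIndependent_rows_of_det_ne_zero hdet
  exact LinearIndependent.of_comp (LinearMap.funLeft ℂ ℂ ρ) hN

/-- Entries are eliminated from the bottom up. As `w b` vanishes below row `ρ b`, clearing that row
does not disturb the rows already cleared. -/
theorem exists_span_eliminating {ρ : Fin k → Fin n} (hρ : StrictMono ρ) (w : Fin k → Fin n → ℂ)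
    (v : Fin n → ℂ) (Q : Finset (Fin k)) (hw : ∀ j ∈ Q, w j (ρ j) ≠ 0)
    (hw0 : ∀ j ∈ Q, ∀ i, ρ j < i → w j i = 0) :
    ∃ x ∈ span ℂ (w '' Q), ∀ j ∈ Q, (v - x) (ρ j) = 0 := by
  induction Q using Finset.induction_on_min with
  | empty => exact ⟨0, zero_mem _, by simp⟩
  | insert b Q hb ih =>
    obtain ⟨x, hx, hxQ⟩ := ih (fun j hj => hw j (Finset.mem_insert_of_mem hj))
      (fun j hj => hw0 j (Finset.mem_insert_of_mem hj))
    refine ⟨x + ((v - x) (ρ b) / w b (ρ b)) • w b, ?_, ?_⟩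
    · refine add_mem (Submodule.span_mono (Set.image_mono ?_) hx)
        (smul_mem _ _ (subset_span ⟨b, by simp, rfl⟩))
      simp
    · intro j hj
      rcases Finset.mem_insert.1 hj with rfl | hj'
      · have := hw j hj
        simp only [Pi.sub_apply, Pi.add_apply, Pi.smul_apply, smul_eq_mul]
        field_simp
        ring
      · have h1 := hxQ j hj'
        have h2 := hw0 b (Finset.mem_insert_self _ _) (ρ j) (hρ (hb j hj'))
        simp only [Pi.sub_apply, Pi.add_apply, Pi.smul_apply, smul_eq_mul] at h1 ⊢
        rw [h2, mul_zero, add_zero, h1]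

end Echelon

/-! ### Normalization of transversals of the family. -/

namespace Board

section Family

open Submodule (span subset_span span_le mem_sup smul_mem)
open scoped Classical

variable {k n : ℕ} {B B' : Board k n} {r r' : Fin n} {E : Fin k → Prop}

theorem NW.le_row {i : Fin n} {j : Fin k} (h : B.NW i j) : i ≤ B.row j := h.1

theorem InSquare.nw_trans {i l : Fin n} {j j' : Fin k} (hsq : B.InSquare l j') (h : B.NW l j)
    (h' : B.NW i j') : B.NW i j := by
  obtain ⟨rfl, hcol⟩ := hsq
  exact ⟨h'.1.trans h.1, h'.2.trans (hcol ▸ h.2)⟩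

theorem apply_eq_zero_of_row_lt {Y : Fin n → ℂ} {j : Fin k}
    (hY : Y ∈ coordSubspace {i | B.NW i j}) {i : Fin n} (hi : B.row j < i) : Y i = 0 :=
  hY i fun h : B.NW i j => absurd h.le_row (not_le.2 hi)

theorem NWChange.row_of_region (hB : NWChange B B' r r' E) {j : Fin k} (hj : E j) :
    r' < B'.row j ∧ ¬ B'.NW r' j := by
  rcases hB.classes j with h | h | h | h
  · exact absurd hj h.1
  · exact absurd hj h.1
  · exact ⟨h.2.1, h.2.2.2.2.2⟩
  · exact absurd hj h.1

/-- Undo the shear on all columns at once. The columns outside `E` return to `Y j`, and those in `E`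
change only in row `r'`, strictly above their red checker, so the echelon form persists. -/
theorem NWChange.linearIndependent_columnShear (hB : NWChange B B' r r' E) (hr : r ≠ r')
    (hrow : StrictMono B'.row) (t : ℂ) {Y : Fin k → Fin n → ℂ}
    (hY : ∀ j, Y j ∈ coordSubspace {i | B'.NW i j}) (hY1 : ∀ j, Y j (B'.row j) ≠ 0) :
    LinearIndependent ℂ fun j => columnShear hr E t j (Y j) := by
  refine LinearIndependent.of_comp
    ((shear hr t).symm : (Fin n → ℂ) →ₗ[ℂ] (Fin n → ℂ)) ?_
  have key : ∀ j i, B'.row j ≤ i → (shear hr t).symm (columnShear hr E t j (Y j)) i = Y j i := by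
    intro j i hi
    by_cases hE : E j
    · rw [columnShear_of hr t hE, LinearEquiv.refl_apply, shear_symm_apply, if_neg]
      exact ((hB.row_of_region hE).1.trans_le hi).ne'
    · rw [columnShear_of_not hr t hE, LinearEquiv.symm_apply_apply]
  refine linearIndependent_of_echelon hrow (fun j => ?_) fun j i hi => ?_
  · change (shear hr t).symm (columnShear hr E t j (Y j)) _ ≠ 0
    rw [key j _ le_rfl]
    exact hY1 j
  · change (shear hr t).symm (columnShear hr E t j (Y j)) _ = 0
    rw [key j i hi.le]
    exact apply_eq_zero_of_row_lt (hY j) hi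

/-- Normalization of a transversal to Stiefel coordinates, by subtracting multiples of the columns
of the red checkers in squares of black checkers. -/
theorem NWChange.exists_normalized (hB : NWChange B B' r r' E) (hr : r ≠ r')
    (hlt : r < r') (hrow : StrictMono B'.row)
    (hsq : ∀ j j', E j → B'.row j' = r → B'.col j' ≠ B'.black.symm r) (t : ℂ)
    {Y : Fin k → Fin n → ℂ} (hY : ∀ j, Y j ∈ coordSubspace {i | B'.NW i j})
    (hY1 : ∀ j, Y j (B'.row j) ≠ 0) (j : Fin k) :
    ∃ y ∈ coordSubspace {i | B'.NW i j}, y (B'.row j) = 1 ∧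
      (∀ i, (∃ j' ≠ j, B'.InSquare i j') → y i = 0) ∧
      columnShear hr E t j y ∈ span ℂ (Set.range fun l => columnShear hr E t l (Y l)) := by
  let T := columnShear hr E t
  let Q : Finset (Fin k) := Finset.univ.filter fun j' =>
    j' ≠ j ∧ B'.InSquare (B'.row j') j' ∧ B'.NW (B'.row j') j
  have hQ : ∀ j', j' ∈ Q ↔ j' ≠ j ∧ B'.InSquare (B'.row j') j' ∧ B'.NW (B'.row j') j := by
    intro j'
    simp [Q]
  -- Column operations act on the sheared vectors, so column `j'` enters in the coordinates of
  -- column `j`. It must stay in the subspace of `j` and be unchanged from its own red checker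
  -- downwards.
  let w : Fin k → Fin n → ℂ := fun j' => (T j).symm (T j' (Y j'))
  have hw : ∀ j' ∈ Q, w j' ∈ coordSubspace {i | B'.NW i j} ∧
      ∀ i, B'.row j' ≤ i → w j' i = Y j' i := by
    intro j' hj'
    obtain ⟨-, hs, hnw⟩ := (hQ j').1 hj'
    have hYj : Y j' ∈ coordSubspace {i | B'.NW i j} :=
      coordSubspace_mono (fun i hi => hs.nw_trans hnw hi) (hY j')
    have hself : w j' = Y j' → w j' ∈ coordSubspace {i | B'.NW i j} ∧
        ∀ i, B'.row j' ≤ i → w j' i = Y j' i := fun h => ⟨h ▸ hYj, fun i _ => by rw [h]⟩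
    by_cases hE : E j <;> by_cases hE' : E j'
    · apply hself
      simp only [w, T, columnShear_of hr t hE, columnShear_of hr t hE']
      rfl
    · apply hself
      -- A shear acts trivially on a vector without entry in row `r`. The hypothesis `hsq` excludes
      -- a red checker in the black square of row `r` here.
      have hz : Y j' r = 0 := by
        rcases hB.classes j' with h | h | h | h
        · exact hY j' r h.2.2.2.2.1
        · exact absurd (h.2.1 ▸ hs.2) (hsq j j' hE h.2.1)
        · exact absurd h.1 hE'
        · exact absurd (hs.nw_trans hnw h.2.2.2.2) (hB.row_of_region hE).2
      ext i
      simp only [w, T, columnShear_of hr t hE, columnShear_of_not hr t hE', LinearEquiv.refl_symm,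
        LinearEquiv.refl_apply, shear_apply, hz, mul_zero, sub_zero, ite_self]
    · have hrow' := (hB.row_of_region hE').1
      have hle := hnw.le_row
      -- Here the mismatch of shears adds an entry in row `r'`, which is allowed in column `j` and
      -- lies strictly above the red checker `j'`.
      have hjr' : B'.NW r' j := by
        have h1 : r < B'.row j := hlt.trans (hrow'.trans_le hle)
        rcases hB.classes j with h | h | h | h
        · exact absurd h.2.1 h1.asymm
        · exact absurd h.2.1 h1.ne'
        · exact absurd h.1 hE
        · exact h.2.2.2.2
      have happ : ∀ i, w j' i = if i = r' then Y j' i + t * Y j' r else Y j' i := by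
        intro i
        simp only [w, T, columnShear_of_not hr t hE, columnShear_of hr t hE',
          LinearEquiv.refl_apply, shear_symm_apply]
      refine ⟨fun i hi => ?_, fun i hi => ?_⟩
      · rw [happ, if_neg, hYj i hi]
        rintro rfl
        exact hi hjr'
      · rw [happ, if_neg (hrow'.trans_le hi).ne']
    · apply hself
      simp only [w, T, columnShear_of_not hr t hE, columnShear_of_not hr t hE',
        LinearEquiv.symm_apply_apply]
  obtain ⟨x, hx, hxQ⟩ := exists_span_eliminating hrow w (Y j) Q
    (fun j' hj' => by
      rw [(hw j' hj').2 _ le_rfl]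
      exact hY1 j')
    (fun j' hj' i hi => by
      rw [(hw j' hj').2 i hi.le]
      exact apply_eq_zero_of_row_lt (hY j') hi)
  have hxj : x ∈ coordSubspace {i | B'.NW i j} := by
    refine span_le.2 ?_ hx
    rintro _ ⟨j', hj', rfl⟩
    exact (hw j' hj').1
  have hx0 : x (B'.row j) = 0 := by
    have hle : span ℂ (w '' Q) ≤ LinearMap.ker (LinearMap.proj (B'.row j) :
        (Fin n → ℂ) →ₗ[ℂ] ℂ) := by
      refine span_le.2 ?_
      rintro _ ⟨j', hj', rfl⟩
      obtain ⟨hne, -, hnw⟩ := (hQ j').1 hj'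
      have hlt : B'.row j' < B'.row j :=
        lt_of_le_of_ne hnw.le_row fun h => hne (hrow.injective h)
      change w j' (B'.row j) = 0
      rw [(hw j' hj').2 _ hlt.le]
      exact apply_eq_zero_of_row_lt (hY j') hlt
    exact hle hx
  have hmem : Y j - x ∈ coordSubspace {i | B'.NW i j} := sub_mem (hY j) hxj
  refine ⟨(Y j (B'.row j))⁻¹ • (Y j - x), smul_mem _ _ hmem, ?_, ?_, ?_⟩
  · rw [Pi.smul_apply, Pi.sub_apply, hx0, sub_zero, smul_eq_mul, inv_mul_cancel₀ (hY1 j)]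
  · rintro i ⟨j', hne, hs⟩
    have hi := hs.1
    subst hi
    rw [Pi.smul_apply]
    by_cases hnw : B'.NW (B'.row j') j
    · rw [hxQ j' ((hQ j').2 ⟨hne, hs, hnw⟩), smul_zero]
    · rw [hmem _ hnw, smul_zero]
  · rw [map_smul, map_sub]
    refine smul_mem _ _ (sub_mem (subset_span ⟨j, rfl⟩) ?_)
    have hle : span ℂ (w '' Q) ≤ (span ℂ (Set.range fun l => T l (Y l))).comap
        (T j : (Fin n → ℂ) →ₗ[ℂ] (Fin n → ℂ)) := by
      refine span_le.2 ?_
      rintro _ ⟨j', -, rfl⟩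
      change T j ((T j).symm (T j' (Y j'))) ∈ span ℂ (Set.range fun l => T l (Y l))
      rw [LinearEquiv.apply_symm_apply]
      exact subset_span ⟨j', rfl⟩
    exact hle hx

/-- The spans of the columns of the family, in the basis `M`. -/
theorem mem_phiImage_family {σ : Equiv.Perm (Fin n)} {d a : Fin n} (hr : σ d ≠ σ a)
    {M : Matrix (Fin n) (Fin n) ℂ} {t : ℂ} {H : Gr k n} :
    H ∈ phiImage M (B'.familyII σ d a t) ↔ ∃ Y ∈ B'.stiefelCoords,
      span ℂ (Set.range fun j =>
        M.mulVec (columnShear hr (InRegionE σ d B') t j (Y.col j))) = H.1 := by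
  have hcol : ∀ Y : Matrix (Fin n) (Fin k) ℂ, ∀ j,
      (M * Matrix.of fun i j => if i = σ a ∧ ¬ InRegionE σ d B' j then Y i j - t * Y (σ d) j
        else Y i j).col j = M.mulVec (columnShear hr (InRegionE σ d B') t j (Y.col j)) := by
    intro Y j
    change M.mulVec (fun i => if i = σ a ∧ ¬ InRegionE σ d B' j then Y i j - t * Y (σ d) j
        else Y i j) = _
    congr 1
    ext i
    by_cases hE : InRegionE σ d B' j
    · simp [columnShear_of hr t hE, hE]
    · simp [columnShear_of_not hr t hE, hE, shear_apply]
  constructor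
  · rintro ⟨A, ⟨_, ⟨Y, hY, rfl⟩, hA⟩, rfl⟩
    refine ⟨Y, hY, ?_⟩
    change _ = span ℂ (Set.range A.1.col)
    rw [hA]
    congr 2
    exact (funext (hcol Y)).symm
  · rintro ⟨Y, hY, hH⟩
    have hH' := hH
    rw [← funext (hcol Y)] at hH'
    refine ⟨⟨_, ?_⟩, ⟨_, ⟨Y, hY, rfl⟩, rfl⟩, Subtype.ext hH'⟩
    rw [Matrix.rank_eq_finrank_span_cols]
    exact (congrArg (fun V : Submodule ℂ (Fin n → ℂ) => Module.finrank ℂ V) hH').trans H.2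

end Family

end Board

/-! ### Density of the family and invariance of the flag in Case II. -/

namespace Board

section CaseII

open Submodule (span subset_span span_le mem_sup smul_mem)

variable {k n : ℕ} {B B' : Board k n} {σ : Equiv.Perm (Fin n)} {d a : Fin n}

theorem col_mem_coordSubspace {Y : Matrix (Fin n) (Fin k) ℂ} (hY : Y ∈ B.stiefelCoords)
    (j : Fin k) : Y.col j ∈ coordSubspace {i | B.NW i j} := fun i hi => (hY i j).1 hi

theorem rank_family (hB : NWChange B B' (σ d) (σ a) (InRegionE σ d B')) (hr : σ d ≠ σ a)
    (hrow : StrictMono B'.row) {M : Matrix (Fin n) (Fin n) ℂ} (hM : IsUnit M.det) {t : ℂ}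
    {Z : Matrix (Fin n) (Fin k) ℂ} (hZ : Z ∈ B'.familyII σ d a t) : (M * Z).rank = k := by
  rw [Matrix.rank_mul_eq_right_of_isUnit_det _ _ hM]
  obtain ⟨Y, hY, rfl⟩ := hZ
  have hli := hB.linearIndependent_columnShear hr hrow t (Y := Y.col) (col_mem_coordSubspace hY)
    fun j => by
      rw [Matrix.col_apply, (hY _ j).2.2 rfl]
      exact one_ne_zero
  refine Eq.trans (congrArg Matrix.rank ?_) (rank_transpose_of_linearIndependent hli)
  ext i j
  by_cases hE : InRegionE σ d B' j
  · simp [columnShear_of hr t hE, hE]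
  · simp [columnShear_of_not hr t hE, hE, shear_apply]

theorem phiImage_family_subset (hr : σ d ≠ σ a) (M : Matrix (Fin n) (Fin n) ℂ) (t : ℂ) :
    phiImage M (B'.familyII σ d a t) ⊆ transversalSpans fun j =>
      ((coordSubspace {i | B'.NW i j}).map (columnShear hr (InRegionE σ d B') t j :
        (Fin n → ℂ) →ₗ[ℂ] (Fin n → ℂ))).map M.mulVecLin := by
  intro H hH
  obtain ⟨Y, hY, hs⟩ := (mem_phiImage_family hr).1 hH
  exact ⟨_, fun j => Submodule.mem_map_of_mem
    (Submodule.mem_map_of_mem (col_mem_coordSubspace hY j)), hs⟩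

/-- Since row `B'.row j` belongs to the index set of `j`, a small perturbation makes the entry there
nonzero for all `j`. Normalization then gives `k` independent columns of the family inside the same
`k`-dimensional space. -/
theorem transversalSpans_subset_closure_family
    (hB : NWChange B B' (σ d) (σ a) (InRegionE σ d B')) (hr : σ d ≠ σ a) (hlt : σ d < σ a)
    (hrow : StrictMono B'.row) (hnw : ∀ j, B'.NW (B'.row j) j)
    (hsq : ∀ j j', InRegionE σ d B' j → B'.row j' = σ d → B'.col j' ≠ B'.black.symm (σ d))
    {M : Matrix (Fin n) (Fin n) ℂ} (hM : IsUnit M.det) (t : ℂ) :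
    transversalSpans (fun j =>
      ((coordSubspace {i | B'.NW i j}).map (columnShear hr (InRegionE σ d B') t j :
        (Fin n → ℂ) →ₗ[ℂ] (Fin n → ℂ))).map M.mulVecLin) ⊆
      closure (phiImage M (B'.familyII σ d a t)) := by
  let T := columnShear hr (InRegionE σ d B') t
  let e : Fin k → (Fin n → ℂ) ≃ₗ[ℂ] (Fin n → ℂ) := fun j => (T j).trans (mulVecEquiv M hM)
  refine (transversalSpans_subset_closure_generic (fun j => e j (Pi.single (B'.row j) 1)) ?_
    fun j => (LinearMap.proj (B'.row j)).comp
      ((e j).symm : (Fin n → ℂ) →ₗ[ℂ] (Fin n → ℂ))).trans (closure_mono ?_)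
  · intro j
    refine Submodule.mem_map_of_mem (f := M.mulVecLin)
      (Submodule.mem_map_of_mem (f := (T j : (Fin n → ℂ) →ₗ[ℂ] (Fin n → ℂ))) fun i hi => ?_)
    rw [Pi.single_eq_of_ne]
    rintro rfl
    exact hi (hnw j)
  · rintro H ⟨c, hc, hs, hgen⟩
    have hex : ∀ j, ∃ Y ∈ coordSubspace {i | B'.NW i j}, c j = e j Y := by
      intro j
      obtain ⟨_, ⟨Y, hY, rfl⟩, hY'⟩ := hc j
      exact ⟨Y, hY, hY'.symm⟩
    choose Y hY hcY using hex
    have hY1 : ∀ j, Y j (B'.row j) ≠ 0 := by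
      intro j
      have h := hgen j (by simp)
      simpa [hcY] using h
    choose y hy hy1 hy0 hspan using hB.exists_normalized hr hlt hrow hsq t hY hY1
    refine (mem_phiImage_family hr).2 ⟨Matrix.of fun i j => y j i, fun i j => ⟨?_, ?_, ?_⟩, ?_⟩
    · exact fun hi => hy j i hi
    · exact hy0 j i
    · rintro rfl
      exact hy1 j
    · have hli := hB.linearIndependent_columnShear hr hrow t hy fun j => by
        rw [hy1]
        exact one_ne_zero
      have hli' := hli.map' (mulVecEquiv M hM : (Fin n → ℂ) →ₗ[ℂ] (Fin n → ℂ))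
        (LinearEquiv.ker _)
      change span ℂ (Set.range fun j => mulVecEquiv M hM (T j (y j))) = H.1
      refine Submodule.eq_of_le_of_finrank_eq ?_ ?_
      · rw [span_le]
        rintro _ ⟨j, rfl⟩
        have h1 := Submodule.mem_map_of_mem
          (f := (mulVecEquiv M hM : (Fin n → ℂ) →ₗ[ℂ] (Fin n → ℂ))) (hspan j)
        rw [Submodule.map_span, ← Set.range_comp] at h1
        rw [← hs, funext hcY]
        exact h1
      · rw [H.2]
        exact (finrank_span_eq_card hli').trans (Fintype.card_fin k)

theorem phiImageDenseIn_family (hB : NWChange B B' (σ d) (σ a) (InRegionE σ d B'))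
    (hlt : σ d < σ a) (hrow : StrictMono B'.row) (hnw : ∀ j, B'.NW (B'.row j) j)
    (hsq : ∀ j j', InRegionE σ d B' j → B'.row j' = σ d → B'.col j' ≠ B'.black.symm (σ d))
    {M : Matrix (Fin n) (Fin n) ℂ} (hM : IsUnit M.det) {t : ℂ} {V : Set (Gr k n)}
    {W : Fin k → Submodule ℂ (Fin n → ℂ)}
    (hW : ∀ j, W j = ((coordSubspace {i | B'.NW i j}).map
      (columnShear hlt.ne (InRegionE σ d B') t j :
        (Fin n → ℂ) →ₗ[ℂ] (Fin n → ℂ))).map M.mulVecLin)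
    (h1 : transversalSpans W ⊆ V) (h2 : V ⊆ closure (transversalSpans W)) :
    PhiImageDenseIn M (B'.familyII σ d a t) V := by
  obtain rfl := funext hW
  exact ⟨fun Y hY => rank_family hB hlt.ne hrow hM hY, (phiImage_family_subset hlt.ne M t).trans h1,
    h2.trans (closure_minimal
      (transversalSpans_subset_closure_family hB hlt.ne hlt hrow hnw hsq hM t) isClosed_closure)⟩

/-- In column order, the vector of column `a` is `m_r` for both bases, and that of column `d`
changes from `m_{r+1}` to `m_r - t m_{r+1}`. As `a < d` and `t ≠ 0`, this is a triangular change of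
basis. -/
theorem flagF_movingBasis (hc : IsCritical B.black d a) (hm : BlackMove d a B B')
    (M : Matrix (Fin n) (Fin n) ℂ) {t : ℂ} (ht : t ≠ 0) :
    flagF B.black (movingBasis M (B.black d) (B.black a) t) = flagF B'.black M := by
  obtain ⟨-, had, hlt, -⟩ := hc
  have e1 : (movingBasis M (B.black d) (B.black a) t).col (B.black d) =
      M.col (B'.black a) - t • M.col (B'.black d) := by
    rw [IsSorting.black_move_ascending hm, IsSorting.black_move_descending hm]
    ext i
    simp [movingBasis]
  have e2 : (movingBasis M (B.black d) (B.black a) t).col (B.black a) = M.col (B'.black a) := by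
    rw [IsSorting.black_move_ascending hm]
    ext i
    simp [movingBasis, hlt.ne']
  have e3 : ∀ l, l ≠ a → l ≠ d → (movingBasis M (B.black d) (B.black a) t).col (B.black l) =
      M.col (B'.black l) := by
    intro l h1 h2
    rw [IsSorting.black_move_of_ne hm h1 h2]
    ext i
    simp [movingBasis, h1, h2]
  ext1 j
  apply le_antisymm
  · refine span_le.2 ?_
    rintro _ ⟨l, hl, rfl⟩
    by_cases hla : l = a
    · subst hla
      rw [e2]
      exact subset_span ⟨l, hl, rfl⟩
    by_cases hld : l = d
    · subst hld
      rw [e1]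
      exact sub_mem (subset_span ⟨a, had.le.trans hl, rfl⟩)
        (smul_mem _ _ (subset_span ⟨l, hl, rfl⟩))
    · rw [e3 l hla hld]
      exact subset_span ⟨l, hl, rfl⟩
  · refine span_le.2 ?_
    rintro _ ⟨l, hl, rfl⟩
    by_cases hla : l = a
    · subst hla
      rw [← e2]
      exact subset_span ⟨l, hl, rfl⟩
    by_cases hld : l = d
    · subst hld
      have e4 : M.col (B'.black l) = t⁻¹ • ((movingBasis M (B.black l) (B.black a) t).col
          (B.black a) - (movingBasis M (B.black l) (B.black a) t).col (B.black l)) := by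
        rw [e1, e2, sub_sub_cancel, smul_smul, inv_mul_cancel₀ ht, one_smul]
      rw [e4]
      exact smul_mem _ _ (sub_mem (subset_span ⟨a, had.le.trans hl, rfl⟩)
        (subset_span ⟨l, hl, rfl⟩))
    · rw [← e3 l hla hld]
      exact subset_span ⟨l, hl, rfl⟩

end CaseII

end Board

theorem lemma3p2 {k n : ℕ} (α β : Fin k ↪o Fin n) (parent child : Board k n)
    (hnode : Board.IsNode α β parent)
    (d a : Fin n) (hcrit : Board.IsCritical parent.black d a)
    (hII : Board.CaseII d a parent child)
    (M : Matrix (Fin n) (Fin n) ℂ) (hM : IsUnit M.det) :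
    (∀ t : ℂ, t ≠ 0 →
      IsUnit (movingBasis M (parent.black d) (parent.black a) t).det ∧
      flagF parent.black (movingBasis M (parent.black d) (parent.black a) t)
        = flagF child.black M ∧
      PhiImageDenseIn M (child.familyII parent.black d a t)
        (parent.variety (movingBasis M (parent.black d) (parent.black a) t))) ∧
    PhiImageDenseIn M (child.familyII parent.black d a 0) (child.variety M) := by
  obtain ⟨d₀, hd₀⟩ := hnode.exists_isSorting
  have hp := hd₀.of_isCritical hcrit
  have hch := hp.caseII hcrit hII
  have hB := hp.nwChange_of_caseII hcrit hII
  have hlt : parent.black d < parent.black a := hcrit.2.2.1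
  have hsq : ∀ j j', Board.InRegionE parent.black d child j →
      child.row j' = parent.black d → child.col j' ≠ child.black.symm (parent.black d) := by
    intro j j' hE hj'
    rw [Board.IsSorting.black_symm_move hII.1, Equiv.symm_apply_apply, Equiv.swap_apply_right]
    exact hp.col_ne_of_inRegionE hcrit hII hE hj'
  refine ⟨fun t ht => ?_, ?_⟩
  · have hM' := isUnit_det_movingBasis hM hlt.ne ht
    exact ⟨hM', Board.flagF_movingBasis hcrit hII.1 M ht,
      Board.phiImageDenseIn_family hB hlt hch.row_strictMono hch.nw_row hsq hM
        (fun j => hB.map_movingBasis hlt.ne M ht j)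
        (parent.transversalSpans_subset_variety _) (hp.variety_subset_closure hM')⟩
  · refine Board.phiImageDenseIn_family hB hlt hch.row_strictMono hch.nw_row hsq hM
      (fun j => ?_) (child.transversalSpans_subset_variety M) (hch.variety_subset_closure hM)
    -- At `t = 0` all shears are the identity, leaving the subspaces of the child itself.
    rw [Board.columnShear_zero]
    exact congrArg _ (Submodule.map_id _).symm
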